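/- Let $M$ be a finite matroid of rank $r$ on the ground set $S$, and assume that $M$ is a split matroid in the sense of Joswig and Schröter: with $P(M)=\operatorname{conv}\{\chi_B : B \text{ a basis of } M\}\subseteq\mathbb{R}^S$ the base polytope and $\Delta=\{x\in[0,1]^S:\sum_{s\in S}x_s=r\}$ the hypersimplex, the affine hulls of any two distinct facets of $P(M)$ have no common point in the relative interior of $\Delta\cap\operatorname{aff}P(M)$. For an ordered pair $(X_1,X_2)$ of bases of $M$ and elements $e\in X_1\setminus X_2$, $f\in X_2\setminus X_1$ such that both $(X_1\setminus\{e\})\cup\{f\}$ and $(X_2\setminus\{f\})\cup\{e\}$ are bases, the pair formed by these two bases is said to be obtained from $(X_1,X_2)$ by a symmetric exchange. Two ordered pairs $(X_1,X_2)$ and $(Y_1,Y_2)$ of bases are called compatible if $|\{i\in\{1,2\}: s\in X_i\}|=|\{i\in\{1,2\}: s\in Y_i\}|$ for every $s\in S$ (equivalently, $X_1\cap X_2=Y_1\cap Y_2$ and $X_1\cup X_2=Y_1\cup Y_2$). Then White's conjecture holds for basis sequences of length two in $M$: for any two ordered pairs $(X_1,X_2)$ and $(Y_1,Y_2)$ of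 bases of $M$, the pair $(Y_1,Y_2)$ can be obtained from $(X_1,X_2)$ by a finite (possibly empty) sequence of symmetric exchanges if and only if the two pairs are compatible. -/

import Mathlib

open Set

/-! Basis sequences of a matroid and White's equivalence. -/

/-- `X'` arises from the sequence `X` of sets by one symmetric exchange in the matroid `M`: for some
positions `i < j` and some `e ∈ X i - X j`, `f ∈ X j - X i` such that `X i - e + f` and
`X j + e - f` are bases, these two sets replace `X i` and `X j`. -/
def SymmExchange {α : Type*} (M : Matroid α) {m : ℕ} (X X' : Fin m → Set α) : Prop :=
  ∃ i j : Fin m, i < j ∧ ∃ e ∈ X i \ X j, ∃ f ∈ X j \ X i,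
    M.IsBase (insert f (X i \ {e})) ∧ M.IsBase (insert e (X j \ {f})) ∧
    X' = Function.update (Function.update X i (insert f (X i \ {e}))) j (insert e (X j \ {f}))

/-- `Y` is obtained from `X` by a (possibly empty) finite composition of symmetric exchanges. -/
def SeqEquivalent {α : Type*} (M : Matroid α) {m : ℕ} (X Y : Fin m → Set α) : Prop :=
  Relation.ReflTransGen (SymmExchange M) X Y

/-- Every element of the ground set lies in as many members of `X` as of `Y`. -/
def SeqCompatible {α : Type*} (M : Matroid α) {m : ℕ} (X Y : Fin m → Set α) : Prop :=
  ∀ s ∈ M.E, {i | s ∈ X i}.ncard = {i | s ∈ Y i}.ncard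

/-! Split matroids, defined polyhedrally.  All polytopes live in `α → ℝ`; the coordinates outside the
ground set are zero. -/

/-- The matroid base polytope: the convex hull of the indicator vectors of the bases. -/
noncomputable def basePolytope {α : Type*} (M : Matroid α) : Set (α → ℝ) :=
  convexHull ℝ {x | ∃ B, M.IsBase B ∧ x = B.indicator 1}

/-- The hypersimplex of order `r` on the (finite) set `E`, i.e. the base polytope of the uniform
matroid of rank `r` on `E`, in its description by inequalities. -/
def hypersimplex {α : Type*} (E : Set α) (r : ℕ) : Set (α → ℝ) :=
  {x | (∀ i, 0 ≤ x i ∧ x i ≤ 1) ∧ (∀ i ∉ E, x i = 0) ∧ ∑ᶠ i ∈ E, x i = r}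

/-- `Φ` is a facet of the polytope `P`: a nonempty (exposed) face of dimension `dim P - 1`. -/
def IsFacet {α : Type*} (P Φ : Set (α → ℝ)) : Prop :=
  Φ.Nonempty ∧ IsExposed ℝ P Φ ∧
    Module.finrank ℝ (vectorSpan ℝ Φ) + 1 = Module.finrank ℝ (vectorSpan ℝ P)

/-- The part of the hypersimplex (with the ground set and the rank of `M`) in the affine hull of the
base polytope of `M`.  If `M` is connected, then it is the hypersimplex itself. -/
noncomputable def ambientPolytope {α : Type*} (M : Matroid α) : Set (α → ℝ) :=
  hypersimplex M.E M.eRank.toNat ∩ affineSpan ℝ (basePolytope M)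

/-- A matroid is split if the hyperplanes (in the affine hull of its base polytope) spanned by the
facets of its base polytope are compatible: no two of them meet in the relative interior of the
ambient polytope.  The facets that are cut out by facets of the hypersimplex impose no condition,
since their hyperplanes miss this relative interior; the others are those along which parts of the
hypersimplex are split off to obtain the base polytope. -/
def IsSplit {α : Type*} (M : Matroid α) : Prop :=
  ∀ Φ Ψ : Set (α → ℝ), IsFacet (basePolytope M) Φ → IsFacet (basePolytope M) Ψ → Φ ≠ Ψ →
    Disjoint ((affineSpan ℝ Φ : Set (α → ℝ)) ∩ affineSpan ℝ Ψ)
      (intrinsicInterior ℝ (ambientPolytope M))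

/-! An obstruction to exchanging `a` for `b` in a base `A` is a set `L ∋ b`, `a ∉ L`, that `A` meets
in as many elements as its rank `ρ L` permits. As long as the hyperplane `∑ i ∈ L, y i = ρ L` does
not cut out a facet of the base polytope, it can be tilted until it contains a further vertex; so
`L` may be taken from the facets, and within one connected component, of rank `k` say. If two such
sets had `#(L ∩ L') + k > ρ L + ρ L'`, then a path through the ambient polytope, starting at the
barycenter of the bases, would reach a common point of their two hyperplanes in its relative
interior. Hence `#(L ∩ L') + k ≤ ρ L + ρ L'` in a split matroid, and distinct sets `L`, `L'` tight
at `A` satisfy `L ∩ L' ⊆ A` and together cover the part of `A` in the component.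

Now let `(B, B')` be compatible with `(A, A')`. If no single exchange brings `A` closer to `B`, then
the obstructions form a cycle of four sets, tight alternately at `A` and at `A'`. Adding up the
inequality for the four mixed pairs yields an element `z` of the two sets tight at one of `A`, `A'`
that lies outside the other two sets. An exchange involving `z` loosens an obstruction, after which
a second exchange brings `A` closer to `B`. -/

open scoped Finset symmDiff

section Exchange

variable {α : Type*} [DecidableEq α] {𝓑 : Set (Finset α)} {A A' B B' : Finset α} {a b x : α}
  {p q r : Finset α × Finset α}

/-- One symmetric exchange between the members of an ordered pair of sets, with both results in the
family `𝓑`. -/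
def PairExchange (𝓑 : Set (Finset α)) (p q : Finset α × Finset α) : Prop :=
  ∃ a ∈ p.1 \ p.2, ∃ b ∈ p.2 \ p.1, insert b (p.1.erase a) ∈ 𝓑 ∧ insert a (p.2.erase b) ∈ 𝓑 ∧
    q = (insert b (p.1.erase a), insert a (p.2.erase b))

/-- Compatibility of ordered pairs of sets: every element lies in as many members of `p` as of
`q`. -/
def PairCompatible (p q : Finset α × Finset α) : Prop :=
  p.1 ∩ p.2 = q.1 ∩ q.2 ∧ p.1 ∪ p.2 = q.1 ∪ q.2

/-- Exchanges within `𝓑` lead from `p` to a pair that is strictly closer to `q`, in the sense that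
the first members have a smaller symmetric difference. -/
def CanApproach (𝓑 : Set (Finset α)) (p q : Finset α × Finset α) : Prop :=
  ∃ p', Relation.ReflTransGen (PairExchange 𝓑) p p' ∧ #(p'.1 ∆ q.1) < #(p.1 ∆ q.1)

namespace PairCompatible

theorem symm (h : PairCompatible p q) : PairCompatible q p :=
  ⟨h.1.symm, h.2.symm⟩

theorem trans (h : PairCompatible p q) (h' : PairCompatible q r) : PairCompatible p r :=
  ⟨h.1.trans h'.1, h.2.trans h'.2⟩

theorem swap (h : PairCompatible p q) : PairCompatible p.swap q.swap := by
  simpa only [PairCompatible, Prod.fst_swap, Prod.snd_swap, Finset.inter_comm, Finset.union_comm]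
    using h

theorem mem_fst_sdiff_iff (h : PairCompatible p q) : x ∈ p.1 \ q.1 ↔ x ∈ q.2 \ p.2 := by
  have hi := Finset.ext_iff.1 h.1 x
  have hu := Finset.ext_iff.1 h.2 x
  simp only [Finset.mem_inter, Finset.mem_union, Finset.mem_sdiff] at *
  tauto

theorem symmDiff_eq (h : PairCompatible p q) : p.1 ∆ q.1 = p.2 ∆ q.2 := by
  ext x
  have hp := h.mem_fst_sdiff_iff (x := x)
  have hq := h.symm.mem_fst_sdiff_iff (x := x)
  simp only [Finset.mem_symmDiff, Finset.mem_sdiff] at *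
  tauto

theorem mem_sdiff_left (h : PairCompatible p q) (hx : x ∈ p.1 \ q.1) : x ∈ p.1 \ p.2 :=
  Finset.mem_sdiff.2 ⟨(Finset.mem_sdiff.1 hx).1, (Finset.mem_sdiff.1 (h.mem_fst_sdiff_iff.1 hx)).2⟩

theorem mem_sdiff_right (h : PairCompatible p q) (hx : x ∈ q.1 \ p.1) : x ∈ p.2 \ p.1 :=
  Finset.mem_sdiff.2
    ⟨(Finset.mem_sdiff.1 (h.symm.mem_fst_sdiff_iff.1 hx)).1, (Finset.mem_sdiff.1 hx).2⟩

end PairCompatible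

namespace PairExchange

theorem swap (h : PairExchange 𝓑 p q) : PairExchange 𝓑 p.swap q.swap := by
  obtain ⟨a, ha, b, hb, hA, hA', rfl⟩ := h
  exact ⟨b, hb, a, ha, hA', hA, rfl⟩

theorem reflTransGen_swap (h : Relation.ReflTransGen (PairExchange 𝓑) p q) :
    Relation.ReflTransGen (PairExchange 𝓑) p.swap q.swap :=
  h.lift Prod.swap fun _ _ => swap

theorem pairCompatible (h : PairExchange 𝓑 p q) : PairCompatible p q := by
  obtain ⟨a, ha, b, hb, -, -, rfl⟩ := h
  rw [Finset.mem_sdiff] at ha hb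
  constructor <;> ext x <;> grind

theorem mem_and_mem (h : PairExchange 𝓑 p q) : q.1 ∈ 𝓑 ∧ q.2 ∈ 𝓑 := by
  obtain ⟨a, -, b, -, hA, hA', rfl⟩ := h
  exact ⟨hA, hA'⟩

theorem reflTransGen_pairCompatible (h : Relation.ReflTransGen (PairExchange 𝓑) p q) :
    PairCompatible p q := by
  induction h with
  | refl => exact ⟨rfl, rfl⟩
  | tail _ h ih => exact ih.trans h.pairCompatible

theorem reflTransGen_mem_and_mem (h : Relation.ReflTransGen (PairExchange 𝓑) p q)
    (hp : p.1 ∈ 𝓑 ∧ p.2 ∈ 𝓑) : q.1 ∈ 𝓑 ∧ q.2 ∈ 𝓑 := by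
  cases h with
  | refl => exact hp
  | tail _ h => exact h.mem_and_mem

end PairExchange

theorem CanApproach.swap (h : CanApproach 𝓑 p.swap q.swap) (hpq : PairCompatible p q) :
    CanApproach 𝓑 p q := by
  obtain ⟨p', hp', hlt⟩ := h
  have hp'' := PairExchange.reflTransGen_swap hp'
  have hp'q : PairCompatible p'.swap q :=
    (PairExchange.reflTransGen_pairCompatible hp'').symm.trans hpq
  refine ⟨p'.swap, hp'', ?_⟩
  rwa [hp'q.symmDiff_eq, hpq.symmDiff_eq]

theorem card_symmDiff_insert_erase_lt (ha : a ∈ A \ B) (hb : b ∈ B \ A) :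
    #((insert b (A.erase a)) ∆ B) < #(A ∆ B) := by
  refine (Finset.card_le_card fun x hx => ?_ : _ ≤ #((A ∆ B).erase b)).trans_lt
    (Finset.card_erase_lt_of_mem <| Finset.mem_symmDiff.2 <| .inr <| Finset.mem_sdiff.1 hb)
  rw [Finset.mem_sdiff] at ha hb
  simp only [Finset.mem_symmDiff, Finset.mem_insert, Finset.mem_erase] at hx ⊢
  grind

theorem card_symmDiff_insert_erase_le (hb : b ∈ B \ A) :
    #((insert b (A.erase x)) ∆ B) ≤ #(A ∆ B) := by
  have hbAB : b ∈ A ∆ B := Finset.mem_symmDiff.2 <| .inr <| Finset.mem_sdiff.1 hb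
  rw [← Finset.card_erase_add_one hbAB]
  refine (Finset.card_le_card fun y hy => ?_).trans (Finset.card_insert_le x _)
  rw [Finset.mem_sdiff] at hb
  simp only [Finset.mem_symmDiff, Finset.mem_insert, Finset.mem_erase] at hy ⊢
  grind

theorem PairCompatible.canApproach_of_exchange (h : PairCompatible (A, A') (B, B'))
    (ha : a ∈ A \ B) (hb : b ∈ B \ A) (hA : insert b (A.erase a) ∈ 𝓑)
    (hA' : insert a (A'.erase b) ∈ 𝓑) : CanApproach 𝓑 (A, A') (B, B') :=
  ⟨_, .single ⟨a, h.mem_sdiff_left ha, b, h.mem_sdiff_right hb, hA, hA', rfl⟩,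
    card_symmDiff_insert_erase_lt ha hb⟩

theorem reflTransGen_pairExchange_of_canApproach
    (happroach : ∀ p q : Finset α × Finset α, p.1 ∈ 𝓑 ∧ p.2 ∈ 𝓑 → q.1 ∈ 𝓑 ∧ q.2 ∈ 𝓑 →
      PairCompatible p q → p.1 ≠ q.1 → CanApproach 𝓑 p q)
    (hp : p.1 ∈ 𝓑 ∧ p.2 ∈ 𝓑) (hq : q.1 ∈ 𝓑 ∧ q.2 ∈ 𝓑) (hpq : PairCompatible p q) :
    Relation.ReflTransGen (PairExchange 𝓑) p q := by
  induction hd : #(p.1 ∆ q.1) using Nat.strong_induction_on generalizing p with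
  | _ d ih =>
    subst hd
    by_cases hne : p.1 = q.1
    · have hne' : p.2 = q.2 := by
        rw [← symmDiff_eq_bot, ← hpq.symmDiff_eq, hne, symmDiff_self]
      exact Prod.ext hne hne' ▸ .refl
    · obtain ⟨p', hp', hlt⟩ := happroach p q hp hq hpq hne
      exact hp'.trans (ih _ hlt (PairExchange.reflTransGen_mem_and_mem hp' hp)
        ((PairExchange.reflTransGen_pairCompatible hp').symm.trans hpq) rfl)

end Exchange

section Count

variable {α : Type*} [DecidableEq α] {A B S : Finset α} {a b : α}

theorem exists_mem_sdiff_of_card_inter_le (hAB : #(B ∩ S) ≤ #(A ∩ S)) (hb : b ∈ B \ A)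
    (hbS : b ∈ S) : ∃ a ∈ A \ B, a ∈ S := by
  by_contra! hno
  refine hAB.not_gt (Finset.card_lt_card ((Finset.ssubset_iff_of_subset fun a ha => ?_).2 ⟨b, ?_⟩))
  · have := hno a
    grind
  · grind

theorem card_insert_erase_inter (ha : a ∈ A) (hb : b ∉ A) :
    #(insert b (A.erase a) ∩ S) + (if a ∈ S then 1 else 0) =
      #(A ∩ S) + if b ∈ S then 1 else 0 := by
  have hbS : b ∉ (A ∩ S).erase a := by simp [hb]
  split_ifs with haS hbS' hbS'
  · rw [Finset.insert_inter_of_mem hbS', Finset.erase_inter, Finset.card_insert_of_notMem hbS,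
      Finset.card_erase_add_one (Finset.mem_inter.2 ⟨ha, haS⟩)]
  · rw [Finset.insert_inter_of_notMem hbS', Finset.erase_inter,
      Finset.card_erase_add_one (Finset.mem_inter.2 ⟨ha, haS⟩), add_zero]
  · rw [Finset.insert_inter_of_mem hbS', Finset.erase_inter, Finset.card_insert_of_notMem hbS,
      Finset.erase_eq_of_notMem (by simp [haS]), add_zero]
  · rw [Finset.insert_inter_of_notMem hbS', Finset.erase_inter,
      Finset.erase_eq_of_notMem (by simp [haS])]

theorem two_mul_card_inter_add_card_inter_lt {S₁ S₂ T₁ T₂ : Finset α} {x : α}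
    (hS : S₁ ∩ S₂ ⊆ T₁ ∪ T₂) (hT : T₁ ∩ T₂ ⊆ S₁ ∪ S₂) (hx : x ∈ (S₁ ∪ S₂) ∩ (T₁ ∪ T₂))
    (hxS : x ∉ S₁ ∩ S₂) (hxT : x ∉ T₁ ∩ T₂) :
    2 * (#(S₁ ∩ S₂) + #(T₁ ∩ T₂)) <
      #(S₁ ∩ T₁) + #(S₁ ∩ T₂) + (#(S₂ ∩ T₁) + #(S₂ ∩ T₂)) := by
  have hcard {S T : Finset α} (hS : S ⊆ S₁ ∪ S₂ ∪ T₁ ∪ T₂) :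
      #(S ∩ T) = ∑ y ∈ S₁ ∪ S₂ ∪ T₁ ∪ T₂, if y ∈ S ∧ y ∈ T then 1 else 0 := by
    rw [← Finset.card_filter]
    congr 1
    grind
  have hS₁ : S₁ ⊆ S₁ ∪ S₂ ∪ T₁ ∪ T₂ := by grind
  have hS₂ : S₂ ⊆ S₁ ∪ S₂ ∪ T₁ ∪ T₂ := by grind
  have hT₁ : T₁ ⊆ S₁ ∪ S₂ ∪ T₁ ∪ T₂ := by grind
  rw [hcard hS₁, hcard hT₁, hcard hS₁, hcard hS₁, hcard hS₂, hcard hS₂,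
    ← Finset.sum_add_distrib, Finset.mul_sum, ← Finset.sum_add_distrib,
    ← Finset.sum_add_distrib, ← Finset.sum_add_distrib]
  simp only [Finset.mem_inter, Finset.mem_union, Finset.subset_iff] at hS hT hx hxS hxT
  refine Finset.sum_lt_sum (fun y _ => ?_) ⟨x, by simp only [Finset.mem_union]; tauto, ?_⟩
  · have hSy := @hS y
    have hTy := @hT y
    by_cases y ∈ S₁ <;> by_cases y ∈ S₂ <;> by_cases y ∈ T₁ <;> by_cases y ∈ T₂ <;> simp_all
  · by_cases x ∈ S₁ <;> by_cases x ∈ S₂ <;> by_cases x ∈ T₁ <;> by_cases x ∈ T₂ <;> simp_all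

end Count

section Split

variable {α : Type*} [DecidableEq α] {𝓑 𝓛 : Set (Finset α)} {C : Finset α} {k : ℕ}
  {ρ : Finset α → ℕ} {A A' B B' L L' T T' T₁ T₂ T₁' T₂' : Finset α} {a a₁ a₂ b b₁ b₂ x y z : α}

/-- `L` is a member of `𝓛` that `A` meets in as many elements as the bound `ρ L` permits. -/
def IsTight (𝓛 : Set (Finset α)) (ρ : Finset α → ℕ) (A L : Finset α) : Prop :=
  L ∈ 𝓛 ∧ #(A ∩ L) = ρ L

/-- What a connected component `C` of rank `k` of a split matroid with set of bases `𝓑` retains of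
the polyhedral definition: subsets `L ∈ 𝓛` of `C`, in which no base has more than `ρ L` elements,
obstruct every exchange within `C` that fails, and the corresponding hyperplanes do not meet inside
the hypersimplex. -/
structure SplitSystem (𝓑 : Set (Finset α)) (C : Finset α) (k : ℕ) (𝓛 : Set (Finset α))
    (ρ : Finset α → ℕ) : Prop where
  card_inter : ∀ ⦃A⦄, A ∈ 𝓑 → #(A ∩ C) = k
  subset : ∀ ⦃L⦄, L ∈ 𝓛 → L ⊆ C
  card_inter_le : ∀ ⦃A⦄, A ∈ 𝓑 → ∀ ⦃L⦄, L ∈ 𝓛 → #(A ∩ L) ≤ ρ L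
  exists_isTight : ∀ ⦃A⦄, A ∈ 𝓑 → ∀ ⦃a b⦄, a ∈ A ∩ C → b ∈ C \ A → insert b (A.erase a) ∉ 𝓑 →
    ∃ L, IsTight 𝓛 ρ A L ∧ b ∈ L ∧ a ∉ L
  card_inter_add_le : ∀ ⦃L₁⦄, L₁ ∈ 𝓛 → ∀ ⦃L₂⦄, L₂ ∈ 𝓛 → L₁ ≠ L₂ → #(L₁ ∩ L₂) + k ≤ ρ L₁ + ρ L₂

/-- `T` is tight at `A`, contains `x` and `y`, and avoids `u` and `v`. -/
structure IsTightSeparator (𝓛 : Set (Finset α)) (ρ : Finset α → ℕ) (A T : Finset α)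
    (x y u v : α) : Prop where
  isTight : IsTight 𝓛 ρ A T
  left_mem : x ∈ T
  right_mem : y ∈ T
  left_notMem : u ∉ T
  right_notMem : v ∉ T

/-- The configuration of tight sets that remains when no exchange of one of `a₁, a₂ ∈ A` for one of
`b₁, b₂ ∈ A'` is possible: `a₁, b₁, a₂, b₂` are joined in a cycle by sets tight alternately at `A`
and at `A'`. -/
structure TightCycle (𝓛 : Set (Finset α)) (ρ : Finset α → ℕ) (A A' : Finset α)
    (a₁ a₂ b₁ b₂ : α) (T₁ T₂ T₁' T₂' : Finset α) : Prop where
  left₁ : IsTightSeparator 𝓛 ρ A T₁ a₁ b₁ a₂ b₂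
  left₂ : IsTightSeparator 𝓛 ρ A T₂ a₂ b₂ a₁ b₁
  right₁ : IsTightSeparator 𝓛 ρ A' T₁' a₁ b₂ a₂ b₁
  right₂ : IsTightSeparator 𝓛 ρ A' T₂' a₂ b₁ a₁ b₂

theorem IsTightSeparator.symm (h : IsTightSeparator 𝓛 ρ A T a₁ b₁ a₂ b₂) :
    IsTightSeparator 𝓛 ρ A T b₁ a₁ b₂ a₂ :=
  ⟨h.isTight, h.right_mem, h.left_mem, h.right_notMem, h.left_notMem⟩

theorem TightCycle.swap (h : TightCycle 𝓛 ρ A A' a₁ a₂ b₁ b₂ T₁ T₂ T₁' T₂') :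
    TightCycle 𝓛 ρ A' A b₁ b₂ a₂ a₁ T₂' T₁' T₁ T₂ :=
  ⟨h.right₂.symm, h.right₁.symm, h.left₁.symm, h.left₂.symm⟩

namespace SplitSystem

/-- The last two terms on the left are the defects of `A` with respect to the two sets. -/
theorem card_inter_add_card_inter_add_le (h : SplitSystem 𝓑 C k 𝓛 ρ) (hA : A ∈ 𝓑) (hL : L ∈ 𝓛)
    (hL' : L' ∈ 𝓛) (hne : L ≠ L') :
    #(A ∩ L) + #(A ∩ L') + #((L ∩ L') \ A) + #((A ∩ C) \ (L ∪ L')) ≤ ρ L + ρ L' := by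
  refine le_trans (le_of_eq ?_) (h.card_inter_add_le hL hL' hne)
  have hunion : #((A ∩ L) ∪ (A ∩ L')) + #((A ∩ C) \ (L ∪ L')) = #(A ∩ C) := by
    rw [← Finset.inter_union_distrib_left, Finset.inter_sdiff_assoc,
      ← Finset.card_inter_add_card_sdiff (A ∩ C) (L ∪ L')]
    congr 2
    · have := h.subset hL
      have := h.subset hL'
      grind
    · grind
  have hinter : #((A ∩ L) ∩ (A ∩ L')) + #((L ∩ L') \ A) = #(L ∩ L') := by
    rw [← Finset.inter_inter_distrib_left, Finset.inter_comm, Finset.card_inter_add_card_sdiff]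
  have := Finset.card_union_add_card_inter (A ∩ L) (A ∩ L')
  have := h.card_inter hA
  omega

theorem inter_subset (h : SplitSystem 𝓑 C k 𝓛 ρ) (hA : A ∈ 𝓑) (hT₁ : IsTight 𝓛 ρ A T₁)
    (hT₂ : IsTight 𝓛 ρ A T₂) (hne : T₁ ≠ T₂) : T₁ ∩ T₂ ⊆ A := by
  have hle := h.card_inter_add_card_inter_add_le hA hT₁.1 hT₂.1 hne
  rw [hT₁.2, hT₂.2] at hle
  rw [← Finset.sdiff_eq_empty_iff_subset, ← Finset.card_eq_zero]
  omega

theorem inter_subset_union (h : SplitSystem 𝓑 C k 𝓛 ρ) (hA : A ∈ 𝓑) (hT₁ : IsTight 𝓛 ρ A T₁)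
    (hT₂ : IsTight 𝓛 ρ A T₂) (hne : T₁ ≠ T₂) : A ∩ C ⊆ T₁ ∪ T₂ := by
  have hle := h.card_inter_add_card_inter_add_le hA hT₁.1 hT₂.1 hne
  rw [hT₁.2, hT₂.2] at hle
  rw [← Finset.sdiff_eq_empty_iff_subset, ← Finset.card_eq_zero]
  omega

theorem exchange_mem (h : SplitSystem 𝓑 C k 𝓛 ρ) (hA : A ∈ 𝓑) (hT : IsTight 𝓛 ρ A T)
    (ha : a ∈ A ∩ C) (hb : b ∈ C \ A) (hab : a ∈ T ↔ b ∈ T) : insert b (A.erase a) ∈ 𝓑 := by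
  by_contra hn
  obtain ⟨L, hL, hbL, haL⟩ := h.exists_isTight hA ha hb hn
  have hne : L ≠ T := fun hLT => haL (hLT ▸ hab.2 (hLT ▸ hbL))
  have hinter : b ∈ L ∩ T → b ∈ A := fun hbLT => h.inter_subset hA hL hT hne hbLT
  have hunion := h.inter_subset_union hA hL hT hne ha
  grind

theorem exists_mem_sdiff_of_mem (h : SplitSystem 𝓑 C k 𝓛 ρ) (hB : B ∈ 𝓑)
    (hT : IsTight 𝓛 ρ A T) (hb : b ∈ B \ A) (hbT : b ∈ T) : ∃ a ∈ A \ B, a ∈ T :=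
  exists_mem_sdiff_of_card_inter_le (hT.2 ▸ h.card_inter_le hB hT.1) hb hbT

theorem exists_mem_sdiff_of_notMem (h : SplitSystem 𝓑 C k 𝓛 ρ) (hA : A ∈ 𝓑) (hB : B ∈ 𝓑)
    (hT : IsTight 𝓛 ρ A T) (ha : a ∈ A \ B) (haC : a ∈ C) (haT : a ∉ T) :
    ∃ b ∈ B \ A, b ∈ C ∧ b ∉ T := by
  have hcard {D : Finset α} (hD : D ∈ 𝓑) : #(D ∩ T) + #(D ∩ (C \ T)) = k := by
    rw [← h.card_inter hD, ← Finset.inter_sdiff_assoc,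
      ← Finset.card_inter_add_card_sdiff (D ∩ C) T, Finset.inter_assoc,
      Finset.inter_eq_right.2 (h.subset hT.1)]
  have hle : #(A ∩ (C \ T)) ≤ #(B ∩ (C \ T)) := by
    have := hcard hA
    have := hcard hB
    have := h.card_inter_le hB hT.1
    have := hT.2
    omega
  obtain ⟨b, hb, hbCT⟩ := exists_mem_sdiff_of_card_inter_le hle ha (Finset.mem_sdiff.2 ⟨haC, haT⟩)
  exact ⟨b, hb, Finset.mem_sdiff.1 hbCT⟩

theorem add_le_of_isTight (h : SplitSystem 𝓑 C k 𝓛 ρ) (hA : A ∈ 𝓑) (hT₁ : IsTight 𝓛 ρ A T₁)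
    (hT₂ : IsTight 𝓛 ρ A T₂) : ρ T₁ + ρ T₂ ≤ k + #(T₁ ∩ T₂) := by
  rw [← hT₁.2, ← hT₂.2, ← h.card_inter hA, ← Finset.card_union_add_card_inter,
    ← Finset.inter_union_distrib_left, ← Finset.inter_inter_distrib_left]
  exact Nat.add_le_add (Finset.card_le_card <| Finset.inter_subset_inter_left <|
    Finset.union_subset (h.subset hT₁.1) (h.subset hT₂.1))
    (Finset.card_le_card Finset.inter_subset_right)

theorem exists_mem_inter_of_tightCycle (h : SplitSystem 𝓑 C k 𝓛 ρ) (hA : A ∈ 𝓑) (hA' : A' ∈ 𝓑)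
    (hc : TightCycle 𝓛 ρ A A' a₁ a₂ b₁ b₂ T₁ T₂ T₁' T₂') :
    (∃ z ∈ T₁ ∩ T₂, z ∉ T₁' ∪ T₂') ∨ ∃ z ∈ T₁' ∩ T₂', z ∉ T₁ ∪ T₂ := by
  obtain ⟨l₁, l₂, r₁, r₂⟩ := hc
  by_contra! hcon
  have hlt := two_mul_card_inter_add_card_inter_lt hcon.1 hcon.2 (x := a₁)
    (by simp [l₁.left_mem, r₁.left_mem]) (by simp [l₂.left_notMem]) (by simp [r₂.left_notMem])
  have := h.add_le_of_isTight hA l₁.isTight l₂.isTight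
  have := h.add_le_of_isTight hA' r₁.isTight r₂.isTight
  have := h.card_inter_add_le l₁.isTight.1 r₁.isTight.1
    fun heq => l₁.right_notMem (heq ▸ r₁.right_mem)
  have := h.card_inter_add_le l₁.isTight.1 r₂.isTight.1
    fun heq => l₁.left_notMem (heq ▸ r₂.left_mem)
  have := h.card_inter_add_le l₂.isTight.1 r₁.isTight.1
    fun heq => l₂.left_notMem (heq ▸ r₁.left_mem)
  have := h.card_inter_add_le l₂.isTight.1 r₂.isTight.1
    fun heq => l₂.right_notMem (heq ▸ r₂.right_mem)
  omega

/-- The exchange of `z` for `b₂` loosens `T₁`, the only obstruction to exchanging `a₂` for `b₁`. -/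
theorem exchange_exchange_mem (h : SplitSystem 𝓑 C k 𝓛 ρ) (hA : A ∈ 𝓑)
    (h₁ : IsTightSeparator 𝓛 ρ A T₁ a₁ b₁ a₂ b₂) (h₂ : IsTightSeparator 𝓛 ρ A T₂ a₂ b₂ a₁ b₁)
    (ha₂ : a₂ ∈ A) (hb₁ : b₁ ∉ A) (hb₂ : b₂ ∉ A) (hz : z ∈ T₁ ∩ T₂) (hzA : z ∈ A) :
    insert b₂ (A.erase z) ∈ 𝓑 ∧ insert b₁ ((insert b₂ (A.erase z)).erase a₂) ∈ 𝓑 := by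
  obtain ⟨t₁, -, hb₁T₁, ha₂T₁, hb₂T₁⟩ := h₁
  obtain ⟨t₂, ha₂T₂, hb₂T₂, -, hb₁T₂⟩ := h₂
  rw [Finset.mem_inter] at hz
  have hT₁C := h.subset t₁.1
  have hT₂C := h.subset t₂.1
  set A₁ := insert b₂ (A.erase z) with hA₁
  have hA₁mem : A₁ ∈ 𝓑 := h.exchange_mem hA t₂ (by grind) (by grind) (by tauto)
  refine ⟨hA₁mem, ?_⟩
  by_contra hn
  obtain ⟨L, tL, hb₁L, ha₂L⟩ :=
    h.exists_isTight hA₁mem (a := a₂) (b := b₁) (by grind) (by grind) hn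
  have hdrop : #(A₁ ∩ T₁) + 1 = ρ T₁ := by
    simpa [hz.1, hb₂T₁, t₁.2, hA₁] using card_insert_erase_inter (S := T₁) hzA hb₂
  have hne : L ≠ T₁ := by
    rintro rfl
    have := tL.2
    omega
  have hle := h.card_inter_add_card_inter_add_le hA₁mem tL.1 t₁.1 hne
  have hb₁pos : 0 < #((L ∩ T₁) \ A₁) := Finset.card_pos.2 ⟨b₁, by grind⟩
  have ha₂pos : 0 < #((A₁ ∩ C) \ (L ∪ T₁)) := Finset.card_pos.2 ⟨a₂, by grind⟩
  have := tL.2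
  omega

/-- An exchange outside `T` preserves the tightness of `T`. -/
theorem exchange_exchange_mem_of_notMem (h : SplitSystem 𝓑 C k 𝓛 ρ) (hA : A ∈ 𝓑)
    (hT : IsTight 𝓛 ρ A T) (ha : a ∈ A ∩ C) (hb : b ∈ C \ A) (haT : a ∉ T) (hbT : b ∉ T)
    (hx : x ∈ A) (hy : y ∉ A) (hxT : x ∈ T) (hyT : y ∈ T) :
    insert b (A.erase a) ∈ 𝓑 ∧ insert y ((insert b (A.erase a)).erase x) ∈ 𝓑 := by
  have hmem := h.exchange_mem hA hT ha hb (iff_of_false haT hbT)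
  have htight : IsTight 𝓛 ρ (insert b (A.erase a)) T := by
    refine ⟨hT.1, ?_⟩
    simpa only [haT, hbT, hT.2, if_false, add_zero] using
      card_insert_erase_inter (S := T) (Finset.mem_inter.1 ha).1 (Finset.mem_sdiff.1 hb).2
  have hTC := h.subset hT.1
  exact ⟨hmem, h.exchange_mem hmem htight (by grind) (by grind) (iff_of_true hxT hyT)⟩

theorem canApproach_of_mem_inter (h : SplitSystem 𝓑 C k 𝓛 ρ) (hA : A ∈ 𝓑) (hA' : A' ∈ 𝓑)
    (hpq : PairCompatible (A, A') (B, B'))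
    (hc : TightCycle 𝓛 ρ A A' a₁ a₂ b₁ b₂ T₁ T₂ T₁' T₂') (ha₂ : a₂ ∈ A \ B) (hb₁ : b₁ ∈ B \ A)
    (hb₂ : b₂ ∈ B \ A) (hz : z ∈ T₁ ∩ T₂) (hz' : z ∉ T₁' ∪ T₂') :
    CanApproach 𝓑 (A, A') (B, B') := by
  obtain ⟨l₁, l₂, r₁, r₂⟩ := hc
  have ha₂A' : a₂ ∉ A' := (Finset.mem_sdiff.1 (hpq.mem_sdiff_left ha₂)).2
  have hb₁A' : b₁ ∈ A' := (Finset.mem_sdiff.1 (hpq.mem_sdiff_right hb₁)).1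
  have hb₂A' : b₂ ∈ A' := (Finset.mem_sdiff.1 (hpq.mem_sdiff_right hb₂)).1
  have ha₂z : a₂ ≠ z := fun heq => l₁.left_notMem (heq ▸ (Finset.mem_inter.1 hz).1)
  have hb₁b₂ : b₁ ≠ b₂ := fun heq => l₁.right_notMem (heq ▸ l₁.right_mem)
  have hzC : z ∈ C := h.subset l₁.isTight.1 (Finset.mem_inter.1 hz).1
  have hbC : b₂ ∈ C := h.subset l₂.isTight.1 l₂.right_mem
  have hzA : z ∈ A := h.inter_subset hA l₁.isTight l₂.isTight
    (fun heq => l₂.right_notMem (heq ▸ l₁.right_mem)) hz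
  have hzA' : z ∉ A' := fun hzA' => hz' <|
    h.inter_subset_union hA' r₁.isTight r₂.isTight
      (fun heq => r₂.right_notMem (heq ▸ r₁.right_mem)) (Finset.mem_inter.2 ⟨hzA', hzC⟩)
  rw [Finset.mem_sdiff] at ha₂ hb₁
  obtain ⟨hA₁, hA₂⟩ := h.exchange_exchange_mem hA l₁ l₂ ha₂.1 hb₁.2 (Finset.mem_sdiff.1 hb₂).2
    hz hzA
  obtain ⟨hA₁', hA₂'⟩ := h.exchange_exchange_mem_of_notMem hA' r₂.isTight
    (Finset.mem_inter.2 ⟨hb₂A', hbC⟩) (Finset.mem_sdiff.2 ⟨hzC, hzA'⟩) r₂.right_notMem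
    (by grind) hb₁A' ha₂A' r₂.right_mem r₂.left_mem
  refine ⟨_, Relation.ReflTransGen.tail (.single ⟨z, by grind, b₂, by grind, hA₁, hA₁', rfl⟩)
    ⟨a₂, by grind, b₁, by grind, hA₂, hA₂', rfl⟩, ?_⟩
  exact (card_symmDiff_insert_erase_lt (by grind) (by grind)).trans_le
    (card_symmDiff_insert_erase_le hb₂)

theorem canApproach_of_tightCycle (h : SplitSystem 𝓑 C k 𝓛 ρ) (hA : A ∈ 𝓑) (hA' : A' ∈ 𝓑)
    (hpq : PairCompatible (A, A') (B, B'))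
    (hc : TightCycle 𝓛 ρ A A' a₁ a₂ b₁ b₂ T₁ T₂ T₁' T₂') (ha₁ : a₁ ∈ A \ B) (ha₂ : a₂ ∈ A \ B)
    (hb₁ : b₁ ∈ B \ A) (hb₂ : b₂ ∈ B \ A) : CanApproach 𝓑 (A, A') (B, B') := by
  have ha₁' := hpq.mem_fst_sdiff_iff.1 ha₁
  have ha₂' := hpq.mem_fst_sdiff_iff.1 ha₂
  have hb₂' := hpq.symm.mem_fst_sdiff_iff.1 hb₂
  obtain ⟨z, hz, hz'⟩ | ⟨z, hz, hz'⟩ := h.exists_mem_inter_of_tightCycle hA hA' hc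
  · exact h.canApproach_of_mem_inter hA hA' hpq hc ha₂ hb₁ hb₂ hz hz'
  · exact CanApproach.swap (h.canApproach_of_mem_inter hA' hA hpq.swap hc.swap hb₂' ha₂' ha₁'
      (Finset.inter_comm T₁' T₂' ▸ hz) hz') hpq

theorem canApproach_of_mem_iff (h : SplitSystem 𝓑 C k 𝓛 ρ) (hA : A ∈ 𝓑) (hA' : A' ∈ 𝓑)
    (hpq : PairCompatible (A, A') (B, B')) (hT : IsTight 𝓛 ρ A T) (hT' : IsTight 𝓛 ρ A' T')
    (ha : a ∈ A \ B) (hb : b ∈ B \ A) (haC : a ∈ C) (hbC : b ∈ C) (hab : a ∈ T ↔ b ∈ T)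
    (hab' : a ∈ T' ↔ b ∈ T') : CanApproach 𝓑 (A, A') (B, B') := by
  have haA := hpq.mem_sdiff_left ha
  have hbA := hpq.mem_sdiff_right hb
  rw [Finset.mem_sdiff] at haA hbA
  exact hpq.canApproach_of_exchange ha hb
    (h.exchange_mem hA hT (Finset.mem_inter.2 ⟨haA.1, haC⟩) (Finset.mem_sdiff.2 ⟨hbC, hbA.2⟩) hab)
    (h.exchange_mem hA' hT' (Finset.mem_inter.2 ⟨hbA.1, hbC⟩) (Finset.mem_sdiff.2 ⟨haC, haA.2⟩)
      hab'.symm)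

theorem exists_isTight_right (h : SplitSystem 𝓑 C k 𝓛 ρ) (hA : A ∈ 𝓑) (hA' : A' ∈ 𝓑)
    (hpq : PairCompatible (A, A') (B, B')) (hstuck : ¬ CanApproach 𝓑 (A, A') (B, B'))
    (hT : IsTight 𝓛 ρ A T) (ha : a ∈ A \ B) (hb : b ∈ B \ A) (haC : a ∈ C) (hbC : b ∈ C)
    (hab : a ∈ T ↔ b ∈ T) : ∃ T', IsTight 𝓛 ρ A' T' ∧ a ∈ T' ∧ b ∉ T' := by
  have haA := hpq.mem_sdiff_left ha
  have hbA := hpq.mem_sdiff_right hb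
  rw [Finset.mem_sdiff] at haA hbA
  refine h.exists_isTight hA' (Finset.mem_inter.2 ⟨hbA.1, hbC⟩) (Finset.mem_sdiff.2 ⟨haC, haA.2⟩)
    fun hmem => hstuck (hpq.canApproach_of_exchange ha hb ?_ hmem)
  exact h.exchange_mem hA hT (Finset.mem_inter.2 ⟨haA.1, haC⟩) (Finset.mem_sdiff.2 ⟨hbC, hbA.2⟩) hab

theorem canApproach_of_common_isTight (h : SplitSystem 𝓑 C k 𝓛 ρ) (hA : A ∈ 𝓑) (hA' : A' ∈ 𝓑)
    (hB' : B' ∈ 𝓑) (hpq : PairCompatible (A, A') (B, B')) (hT : IsTight 𝓛 ρ A T)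
    (hT' : IsTight 𝓛 ρ A' T') (ha₁ : a₁ ∈ A \ B) (ha₂ : a₂ ∈ A \ B) (ha₁T : a₁ ∉ T)
    (ha₂T : a₂ ∈ T) (ha₁T' : a₁ ∈ T') (ha₂T' : a₂ ∈ T') : CanApproach 𝓑 (A, A') (B, B') := by
  obtain ⟨y, hy, hyT'⟩ := h.exists_mem_sdiff_of_mem hB' hT' (hpq.mem_fst_sdiff_iff.1 ha₁) ha₁T'
  have hyB : y ∈ B \ A := hpq.symm.mem_fst_sdiff_iff.2 hy
  have hT'C := h.subset hT'.1
  by_cases hyT : y ∈ T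
  · exact h.canApproach_of_mem_iff hA hA' hpq hT hT' ha₂ hyB (hT'C ha₂T') (hT'C hyT')
      (iff_of_true ha₂T hyT) (iff_of_true ha₂T' hyT')
  · exact h.canApproach_of_mem_iff hA hA' hpq hT hT' ha₁ hyB (hT'C ha₁T') (hT'C hyT')
      (iff_of_false ha₁T hyT) (iff_of_true ha₁T' hyT')

theorem isTightSeparator_and_isTightSeparator (h : SplitSystem 𝓑 C k 𝓛 ρ) (hA : A ∈ 𝓑)
    (hT₁ : IsTight 𝓛 ρ A T₁) (hT₂ : IsTight 𝓛 ρ A T₂) (hne : T₁ ≠ T₂) (ha₁ : a₁ ∈ A ∩ C)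
    (ha₂ : a₂ ∈ A ∩ C) (hb₁ : b₁ ∉ A) (hb₂ : b₂ ∉ A) (hb₁T₁ : b₁ ∈ T₁) (ha₂T₁ : a₂ ∉ T₁)
    (hb₂T₂ : b₂ ∈ T₂) (ha₁T₂ : a₁ ∉ T₂) :
    IsTightSeparator 𝓛 ρ A T₁ a₁ b₁ a₂ b₂ ∧ IsTightSeparator 𝓛 ρ A T₂ a₂ b₂ a₁ b₁ := by
  have hunion := h.inter_subset_union hA hT₁ hT₂ hne
  have hinter {b} (hb : b ∉ A) : ¬ (b ∈ T₁ ∧ b ∈ T₂) := fun hbT =>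
    hb (h.inter_subset hA hT₁ hT₂ hne (Finset.mem_inter.2 hbT))
  exact ⟨⟨hT₁, (Finset.mem_union.1 (hunion ha₁)).resolve_right ha₁T₂, hb₁T₁, ha₂T₁,
      fun hb₂T₁ => hinter hb₂ ⟨hb₂T₁, hb₂T₂⟩⟩,
    ⟨hT₂, (Finset.mem_union.1 (hunion ha₂)).resolve_left ha₂T₁, hb₂T₂, ha₁T₂,
      fun hb₁T₂ => hinter hb₁ ⟨hb₁T₁, hb₁T₂⟩⟩⟩

theorem exists_tightCycle (h : SplitSystem 𝓑 C k 𝓛 ρ) (hA : A ∈ 𝓑) (hA' : A' ∈ 𝓑) (hB : B ∈ 𝓑)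
    (hB' : B' ∈ 𝓑) (hpq : PairCompatible (A, A') (B, B'))
    (hstuck : ¬ CanApproach 𝓑 (A, A') (B, B')) (ha₁ : a₁ ∈ A \ B) (ha₁C : a₁ ∈ C)
    (hb₂ : b₂ ∈ B \ A) (hb₂C : b₂ ∈ C) (hn : insert b₂ (A.erase a₁) ∉ 𝓑) :
    ∃ a₂ ∈ A \ B, ∃ b₁ ∈ B \ A, ∃ T₁ T₂ T₁' T₂',
      TightCycle 𝓛 ρ A A' a₁ a₂ b₁ b₂ T₁ T₂ T₁' T₂' := by
  have hleft {a} (ha : a ∈ A \ B) : a ∈ A ∧ a ∉ A' := Finset.mem_sdiff.1 (hpq.mem_sdiff_left ha)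
  have hright {b} (hb : b ∈ B \ A) : b ∈ A' ∧ b ∉ A := Finset.mem_sdiff.1 (hpq.mem_sdiff_right hb)
  obtain ⟨T₂, t₂, hb₂T₂, ha₁T₂⟩ := h.exists_isTight hA (by grind) (by grind) hn
  obtain ⟨a₂, ha₂, ha₂T₂⟩ := h.exists_mem_sdiff_of_mem hB t₂ hb₂ hb₂T₂
  obtain ⟨b₁, hb₁, hb₁C, hb₁T₂⟩ := h.exists_mem_sdiff_of_notMem hA hB t₂ ha₁ ha₁C ha₁T₂
  have ha₂C : a₂ ∈ C := h.subset t₂.1 ha₂T₂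
  obtain ⟨T₁', t₁', ha₁T₁', hb₁T₁'⟩ := h.exists_isTight_right hA hA' hpq hstuck t₂ ha₁ hb₁ ha₁C hb₁C
    (iff_of_false ha₁T₂ hb₁T₂)
  obtain ⟨T₂', t₂', ha₂T₂', hb₂T₂'⟩ := h.exists_isTight_right hA hA' hpq hstuck t₂ ha₂ hb₂ ha₂C hb₂C
    (iff_of_true ha₂T₂ hb₂T₂)
  have hne : T₁' ≠ T₂' := by
    rintro rfl
    exact hstuck (h.canApproach_of_common_isTight hA hA' hB' hpq t₂ t₁' ha₁ ha₂ ha₁T₂ ha₂T₂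
      ha₁T₁' ha₂T₂')
  obtain ⟨r₁, r₂⟩ := h.isTightSeparator_and_isTightSeparator hA' t₁' t₂' hne
    (a₁ := b₂) (a₂ := b₁) (by grind) (by grind) (hleft ha₁).2 (hleft ha₂).2 ha₁T₁' hb₁T₁'
    ha₂T₂' hb₂T₂'
  obtain ⟨T₁, t₁, hb₁T₁, ha₂T₁⟩ : ∃ T₁, IsTight 𝓛 ρ A T₁ ∧ b₁ ∈ T₁ ∧ a₂ ∉ T₁ := by
    refine h.exists_isTight hA (by grind) (by grind) fun hmem => hstuck ?_
    exact hpq.canApproach_of_exchange ha₂ hb₁ hmem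
      (h.exchange_mem hA' t₂' (by grind) (by grind) (iff_of_true r₂.left_mem ha₂T₂'))
  obtain ⟨l₁, l₂⟩ := h.isTightSeparator_and_isTightSeparator hA t₁ t₂
    (fun heq => ha₂T₁ (heq ▸ ha₂T₂)) (by grind) (by grind) (hright hb₁).2 (hright hb₂).2
    hb₁T₁ ha₂T₁ hb₂T₂ ha₁T₂
  exact ⟨a₂, ha₂, b₁, hb₁, T₁, T₂, T₁', T₂', l₁, l₂, r₁.symm, r₂.symm⟩

theorem canApproach_of_notMem (h : SplitSystem 𝓑 C k 𝓛 ρ) (hA : A ∈ 𝓑) (hA' : A' ∈ 𝓑) (hB : B ∈ 𝓑)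
    (hB' : B' ∈ 𝓑) (hpq : PairCompatible (A, A') (B, B')) (ha : a ∈ A \ B) (haC : a ∈ C)
    (hb : b ∈ B \ A) (hbC : b ∈ C) (hn : insert b (A.erase a) ∉ 𝓑) :
    CanApproach 𝓑 (A, A') (B, B') := by
  by_contra hstuck
  obtain ⟨a₂, ha₂, b₁, hb₁, T₁, T₂, T₁', T₂', hc⟩ :=
    h.exists_tightCycle hA hA' hB hB' hpq hstuck ha haC hb hbC hn
  exact hstuck (h.canApproach_of_tightCycle hA hA' hpq hc ha ha₂ hb₁ hb)

theorem canApproach (h : SplitSystem 𝓑 C k 𝓛 ρ) (hA : A ∈ 𝓑) (hA' : A' ∈ 𝓑) (hB : B ∈ 𝓑)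
    (hB' : B' ∈ 𝓑) (hpq : PairCompatible (A, A') (B, B')) (ha : a ∈ A \ B) (haC : a ∈ C) :
    CanApproach 𝓑 (A, A') (B, B') := by
  obtain ⟨b, hb, hbC⟩ := exists_mem_sdiff_of_card_inter_le
    ((h.card_inter hA).trans (h.card_inter hB).symm).le ha haC
  have ha' := hpq.mem_fst_sdiff_iff.1 ha
  have hb' := hpq.symm.mem_fst_sdiff_iff.1 hb
  by_cases hn : insert b (A.erase a) ∈ 𝓑
  · by_cases hn' : insert a (A'.erase b) ∈ 𝓑
    · exact hpq.canApproach_of_exchange ha hb hn hn'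
    · exact CanApproach.swap
        (h.canApproach_of_notMem hA' hA hB' hB hpq.swap hb' hbC ha' haC hn') hpq
  · exact h.canApproach_of_notMem hA hA' hB hB' hpq ha haC hb hbC hn

end SplitSystem

end Split

section Bases

variable {α : Type*} {M : Matroid α} {A B I L : Finset α} {g : α}

/-- The bases of a finite matroid, as a family of finite sets. -/
def bases (M : Matroid α) : Set (Finset α) := {B | M.IsBase B}

/-- The rank of a finite set, as a natural number. -/
noncomputable def finsetRank (M : Matroid α) (L : Finset α) : ℕ := (M.eRk L).toNat

theorem exists_mem_bases_coe_eq [M.Finite] {B : Set α} (hB : M.IsBase B) :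
    ∃ A ∈ bases M, (A : Set α) = B := by
  obtain ⟨A, rfl⟩ := (M.ground_finite.subset hB.subset_ground).exists_finset_coe
  exact ⟨A, hB, rfl⟩

theorem finite_bases (M : Matroid α) [M.Finite] : (bases M).Finite :=
  (M.ground_finite.toFinset.powerset.finite_toSet).subset fun _ hB =>
    Finset.mem_powerset.2 fun _ hx =>
      M.ground_finite.mem_toFinset.2 (Matroid.IsBase.subset_ground hB hx)

theorem card_eq_of_mem_bases (hA : A ∈ bases M) (hB : B ∈ bases M) : #A = #B := by
  simpa only [Set.encard_coe_eq_coe_finsetCard, Nat.cast_inj] using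
    Matroid.IsBase.encard_eq_encard_of_isBase hA hB

theorem coe_finsetRank (M : Matroid α) (L : Finset α) : (finsetRank M L : ℕ∞) = M.eRk L :=
  ENat.natCast_toNat ((M.eRk_le_encard L).trans_lt L.finite_toSet.encard_lt_top).ne

variable [DecidableEq α]

theorem card_inter_le_finsetRank (hA : A ∈ bases M) (L : Finset α) :
    #(A ∩ L) ≤ finsetRank M L := by
  rw [← ENat.natCast_le_natCast, coe_finsetRank, ← Set.encard_coe_eq_coe_finsetCard,
    Finset.coe_inter]
  exact ((Matroid.IsBase.indep hA).subset Set.inter_subset_left).encard_le_eRk_of_subset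
    Set.inter_subset_right

theorem exists_insert_erase_mem_bases (hA : A ∈ bases M) (hI : I ⊆ A) (hg : g ∉ A)
    (hgI : M.Indep (insert g (I : Set α))) : ∃ e ∈ A \ I, insert g (A.erase e) ∈ bases M := by
  obtain ⟨B', hB', hgIB, hBA⟩ := hgI.exists_isBase_subset_union_isBase hA
  rw [Set.insert_union, Set.union_eq_self_of_subset_left (Finset.coe_subset.2 hI),
    ← Finset.coe_insert] at hBA
  obtain ⟨B, rfl⟩ := ((insert g A).finite_toSet.subset hBA).exists_finset_coe
  rw [Finset.coe_subset] at hBA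
  have hcard : #B + 1 = #(insert g A) := by
    rw [Finset.card_insert_of_notMem hg, card_eq_of_mem_bases hA hB']
  obtain ⟨e, heB, he⟩ := Finset.exists_eq_insert_iff.2 ⟨hBA, hcard⟩
  have hge : g ≠ e := fun h => heB (h ▸ hgIB (Set.mem_insert _ _))
  refine ⟨e, Finset.mem_sdiff.2 ⟨?_, fun h => heB (hgIB (Set.mem_insert_of_mem _ h))⟩, ?_⟩
  · exact Finset.mem_of_mem_insert_of_ne (he ▸ Finset.mem_insert_self e B) hge.symm
  · rwa [← Finset.erase_insert_of_ne hge, ← he, Finset.erase_insert heB]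

theorem card_inter_eq_finsetRank (hA : A ∈ bases M) (hL : (L : Set α) ⊆ M.E)
    (hex : ∀ g ∈ L \ A, ∀ e ∈ A \ L, insert g (A.erase e) ∉ bases M) :
    #(A ∩ L) = finsetRank M L := by
  have hbasis : M.IsBasis (A ∩ L : Finset α) L := by
    have hindep : M.Indep (A ∩ L : Finset α) :=
      (Matroid.IsBase.indep hA).subset (Finset.coe_subset.2 Finset.inter_subset_left)
    refine hindep.isBasis_of_forall_insert (Finset.coe_subset.2 Finset.inter_subset_right)
      fun g hg => ⟨fun hgI => ?_, Set.insert_subset (hL hg.1) hindep.subset_ground⟩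
    have hgA : g ∉ A := fun h => hg.2 (Finset.mem_inter.2 ⟨h, hg.1⟩)
    obtain ⟨e, he, hbase⟩ :=
      exists_insert_erase_mem_bases hA Finset.inter_subset_left hgA hgI
    rw [Finset.sdiff_inter_self_left] at he
    exact hex g (Finset.mem_sdiff.2 ⟨hg.1, hgA⟩) e he hbase
  rw [← ENat.natCast_inj, coe_finsetRank, ← hbasis.encard_eq_eRk, Set.encard_coe_eq_coe_finsetCard]

end Bases

section IndicatorVectors

variable {α : Type*}

/-- The indicator vector of a finite set. -/
noncomputable def indVec (B : Finset α) : α → ℝ := (B : Set α).indicator 1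

/-- The linear functional that adds up the coordinates in `L`. -/
noncomputable def coordSum (L : Finset α) : StrongDual ℝ (α → ℝ) :=
  ∑ i ∈ L, ContinuousLinearMap.proj i

theorem coordSum_apply (L : Finset α) (x : α → ℝ) : coordSum L x = ∑ i ∈ L, x i := by
  simp [coordSum]

variable [DecidableEq α]

theorem indVec_apply (B : Finset α) (i : α) : indVec B i = if i ∈ B then 1 else 0 := by
  simp [indVec, Set.indicator_apply]

theorem coordSum_indVec (L B : Finset α) : coordSum L (indVec B) = #(B ∩ L) := by
  simp [coordSum_apply, indVec_apply, Finset.inter_comm B L]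

theorem indVec_eq_sum_single (B : Finset α) : indVec B = ∑ i ∈ B, Pi.single i 1 := by
  ext j
  simp [indVec_apply, Finset.sum_apply, Pi.single_apply]

theorem coordSum_single (L : Finset α) (i : α) :
    coordSum L (Pi.single i 1) = if i ∈ L then 1 else 0 := by
  simp [coordSum_apply, Pi.single_apply]

theorem indVec_insert_erase_sub {A : Finset α} {e f : α} (he : e ∈ A) (hf : f ∉ A) :
    indVec (insert f (A.erase e)) - indVec A = Pi.single f 1 - Pi.single e 1 := by
  rw [indVec_eq_sum_single, indVec_eq_sum_single, Finset.sum_insert (by simp [hf]),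
    ← Finset.add_sum_erase A _ he, add_sub_add_right_eq_sub]

theorem indVec_sub_indVec_mem {W : Submodule ℝ (α → ℝ)} {C S T : Finset α}
    (hW : ∀ e ∈ C, ∀ f ∈ C, Pi.single f 1 - Pi.single e 1 ∈ W) (hS : S ⊆ C) (hT : T ⊆ C)
    (hST : #S = #T) : indVec S - indVec T ∈ W := by
  rcases T.eq_empty_or_nonempty with rfl | ⟨e, he⟩
  · rw [Finset.card_empty, Finset.card_eq_zero] at hST
    simp [hST]
  have hmem {U : Finset α} (hU : U ⊆ C) :
      indVec U - (#U : ℝ) • (Pi.single e 1 : α → ℝ) ∈ W := by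
    rw [indVec_eq_sum_single, Nat.cast_smul_eq_nsmul, ← Finset.sum_const, ← Finset.sum_sub_distrib]
    exact W.sum_mem fun i hi => hW e (hT he) i (hU hi)
  simpa [hST] using W.sub_mem (hmem hS) (hmem hT)

end IndicatorVectors

section AffineSpan

variable {E : Type*} [AddCommGroup E] [Module ℝ E] {s : Set E} {ℓ : E →ₗ[ℝ] ℝ} {y : E} {c : ℝ}

theorem apply_eq_of_mem_affineSpan (h : ∀ v ∈ s, ℓ v = c) (hy : y ∈ affineSpan ℝ s) : ℓ y = c :=
  AffineMap.eqOn_affineSpan (f := ℓ.toAffineMap) (g := AffineMap.const ℝ E c) h hy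

theorem vectorSpan_le_ker_of_forall_apply_eq (h : ∀ v ∈ s, ℓ v = c) :
    vectorSpan ℝ s ≤ LinearMap.ker ℓ := by
  rw [vectorSpan_def, Submodule.span_le]
  rintro _ ⟨v, hv, w, hw, rfl⟩
  simp [h v hv, h w hw]

end AffineSpan

section Components

variable {α : Type*} {M : Matroid α} {A B L : Finset α} {a e f x : α}

/-- The vertices of the base polytope. -/
def vertices (M : Matroid α) : Set (α → ℝ) := indVec '' bases M

theorem indVec_mem_vertices (hA : A ∈ bases M) : indVec A ∈ vertices M := mem_image_of_mem _ hA

variable [DecidableEq α] [M.Finite]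

open scoped Classical in
/-- The connected component of `x` in `M`, read off from the base polytope: its direction space
contains `Pi.single y 1 - Pi.single x 1` exactly for the elements `y` of the component. -/
noncomputable def component (M : Matroid α) [M.Finite] (x : α) : Finset α :=
  {y ∈ M.ground_finite.toFinset |
    Pi.single y 1 - Pi.single x 1 ∈ vectorSpan ℝ (vertices M)}

theorem mem_component : e ∈ component M x ↔
    e ∈ M.E ∧ Pi.single e 1 - Pi.single x 1 ∈ vectorSpan ℝ (vertices M) := by
  simp [component]

theorem component_subset_ground : (component M x : Set α) ⊆ M.E :=
  fun _ h => (mem_component.1 h).1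

theorem mem_component_self (hA : A ∈ bases M) (ha : a ∈ A) : a ∈ component M a :=
  mem_component.2 ⟨Matroid.IsBase.subset_ground hA ha, by simp⟩

theorem single_sub_single_mem_vectorSpan (he : e ∈ component M x) (hf : f ∈ component M x) :
    Pi.single f 1 - Pi.single e 1 ∈ vectorSpan ℝ (vertices M) := by
  simpa using Submodule.sub_mem _ (mem_component.1 hf).2 (mem_component.1 he).2

theorem mem_component_iff_of_exchange (hA : A ∈ bases M) (he : e ∈ A) (hf : f ∉ A)
    (hex : insert f (A.erase e) ∈ bases M) : e ∈ component M x ↔ f ∈ component M x := by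
  have heE : e ∈ M.E := Matroid.IsBase.subset_ground hA he
  have hfE : f ∈ M.E := Matroid.IsBase.subset_ground hex (Finset.mem_insert_self f _)
  have hfe : Pi.single f 1 - Pi.single e 1 ∈ vectorSpan ℝ (vertices M) :=
    indVec_insert_erase_sub he hf ▸
      vsub_mem_vectorSpan ℝ (indVec_mem_vertices hex) (indVec_mem_vertices hA)
  rw [mem_component, mem_component, and_iff_right heE, and_iff_right hfE,
    ← Submodule.add_mem_iff_right _ hfe, sub_add_sub_cancel]

theorem card_inter_component (hA : A ∈ bases M) :
    #(A ∩ component M x) = finsetRank M (component M x) :=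
  card_inter_eq_finsetRank hA component_subset_ground fun g hg e he hex => by
    rw [Finset.mem_sdiff] at hg he
    exact he.2 ((mem_component_iff_of_exchange hA he.1 hg.2 hex).2 hg.1)

/-- The greedy property, applied to the restriction of `M` to a component. -/
theorem card_inter_superlevel_eq_finsetRank (hA : A ∈ bases M) {c : α → ℝ}
    (hmax : ∀ B ∈ bases M, ∑ i ∈ B, c i ≤ ∑ i ∈ A, c i) (t : ℝ) :
    #(A ∩ {g ∈ component M x | t < c g}) = finsetRank M {g ∈ component M x | t < c g} := by
  refine card_inter_eq_finsetRank hA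
    (subset_trans (Finset.coe_subset.2 (Finset.filter_subset _ _)) component_subset_ground)
    fun g hg e he hex => ?_
  simp only [Finset.mem_sdiff, Finset.mem_filter, not_and, not_lt] at hg he
  have hce : c e ≤ t := he.2 ((mem_component_iff_of_exchange hA he.1 hg.2 hex).2 hg.1.1)
  have hsum := hmax _ hex
  rw [Finset.sum_insert (by simp [hg.2]), ← Finset.add_sum_erase A c he.1] at hsum
  linarith

/-- The set used here is the fundamental circuit of `f`. -/
theorem exists_card_inter_eq_finsetRank (hA : A ∈ bases M) (he : e ∈ A) (hf : f ∉ A)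
    (hfC : f ∈ component M x) (hex : insert f (A.erase e) ∉ bases M) :
    ∃ L ⊆ component M x, #(A ∩ L) = finsetRank M L ∧ f ∈ L ∧ e ∉ L := by
  classical
  have hL : insert f {g ∈ A | insert f (A.erase g) ∈ bases M} ⊆ component M x := by
    refine Finset.insert_subset hfC fun g hg => ?_
    rw [Finset.mem_filter] at hg
    exact (mem_component_iff_of_exchange hA hg.1 hf hg.2).2 hfC
  refine ⟨_, hL, card_inter_eq_finsetRank hA
    (subset_trans (Finset.coe_subset.2 hL) component_subset_ground) fun g hg d hd hgd => ?_,
    Finset.mem_insert_self _ _, ?_⟩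
  · simp only [Finset.mem_sdiff, Finset.mem_insert, Finset.mem_filter, not_or, not_and] at hg hd
    obtain rfl | hgA := hg.1
    · exact hd.2.2 hd.1 hgd
    · exact hg.2 hgA.1
  · rw [Finset.mem_insert, Finset.mem_filter]
    rintro (rfl | h)
    exacts [hf he, hex h.2]

end Components

section TiltedFaces

variable {E : Type*} [AddCommGroup E] [Module ℝ E] {s : Set E} {φ b : E →ₗ[ℝ] ℝ} {u v w : E}

theorem exists_dual_le_ker_of_lt {W V : Submodule ℝ E} (hW : W < V ⊓ LinearMap.ker φ)
    (hu : φ u ≠ 0) :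
    ∃ b : E →ₗ[ℝ] ℝ, W ≤ LinearMap.ker b ∧ b u = 0 ∧ ¬ V ≤ LinearMap.ker b := by
  obtain ⟨v, ⟨hvV, hvφ⟩, hvW⟩ := SetLike.exists_of_lt hW
  have hv : v ∉ W ⊔ Submodule.span ℝ {u} := fun hmem => by
    obtain ⟨w, hw, y, hy, rfl⟩ := Submodule.mem_sup.1 hmem
    obtain ⟨r, rfl⟩ := Submodule.mem_span_singleton.1 hy
    have hwφ : φ w = 0 := (hW.le hw).2
    have hr : r = 0 := by simpa [hwφ, hu] using hvφ
    exact hvW (by simpa [hr] using hw)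
  obtain ⟨b, hbv, hb⟩ := Submodule.exists_le_ker_of_notMem hv
  exact ⟨b, le_sup_left.trans hb,
    hb (Submodule.mem_sup_right (Submodule.mem_span_singleton_self u)), fun h => hbv (h hvV)⟩

theorem exists_dual_apply_eq_of_lt {T : Set E}
    (hT : vectorSpan ℝ T < vectorSpan ℝ s ⊓ LinearMap.ker φ) (hu : φ u ≠ 0) (hv : v ∈ T) :
    ∃ b : E →ₗ[ℝ] ℝ, (∀ y ∈ T, b y = b v) ∧ b u = 0 ∧ ∃ w ∈ s, b v < b w := by
  obtain ⟨b, hbT, hbu, hbs⟩ := exists_dual_le_ker_of_lt hT hu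
  replace hbT : ∀ y ∈ T, b y = b v := fun y hy =>
    sub_eq_zero.1 (map_sub b y v ▸ hbT (vsub_mem_vectorSpan ℝ hy hv))
  obtain ⟨w, hw, hbw⟩ : ∃ w ∈ s, b w ≠ b v := by
    by_contra! hall
    exact hbs (vectorSpan_le_ker_of_forall_apply_eq hall)
  rcases hbw.lt_or_gt with hlt | hlt
  · exact ⟨-b, fun y hy => by simp [hbT y hy], by simp [hbu], w, hw, by simpa using hlt⟩
  · exact ⟨b, hbT, hbu, w, hw, hlt⟩

/-- The parameter `t` is found by the ratio test of linear programming. -/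
theorem exists_tilt (hs : s.Finite) (hφ : ∀ v ∈ s, φ v ≤ φ u) (hw : w ∈ s) (hbw : b u < b w) :
    ∃ t : ℝ, (∀ v ∈ s, (φ + t • b) v ≤ (φ + t • b) u) ∧
      ∃ v ∈ s, b u < b v ∧ (φ + t • b) v = (φ + t • b) u := by
  obtain ⟨v, ⟨hv, hbv⟩, hmin⟩ := Set.exists_min_image {v ∈ s | b u < b v}
    (fun v => (φ u - φ v) / (b v - b u)) (hs.subset (sep_subset _ _)) ⟨w, hw, hbw⟩
  rw [← sub_pos] at hbv
  set t := (φ u - φ v) / (b v - b u)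
  have ht : 0 ≤ t := div_nonneg (sub_nonneg.2 (hφ v hv)) hbv.le
  have htv : t * (b v - b u) = φ u - φ v := div_mul_cancel₀ _ hbv.ne'
  refine ⟨t, fun y hy => ?_, v, hv, sub_pos.1 hbv, ?_⟩
  · suffices t * (b y - b u) ≤ φ u - φ y by
      simp only [LinearMap.add_apply, LinearMap.smul_apply, smul_eq_mul]
      linarith
    rcases le_or_gt (b y - b u) 0 with hby | hby
    · exact (mul_nonpos_of_nonneg_of_nonpos ht hby).trans (sub_nonneg.2 (hφ y hy))
    · exact (le_div_iff₀ hby).1 (hmin y ⟨hy, sub_pos.1 hby⟩)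
  · simp only [LinearMap.add_apply, LinearMap.smul_apply, smul_eq_mul]
    linarith

end TiltedFaces

section FacetSets

variable {α : Type*} [DecidableEq α] {M : Matroid α} {A L : Finset α} {e f x : α}

/-- The bases that meet `L` in as many elements as possible. -/
def tightBases (M : Matroid α) (L : Finset α) : Set (Finset α) :=
  {B ∈ bases M | #(B ∩ L) = finsetRank M L}

theorem tightBases_subset_bases : tightBases M L ⊆ bases M := sep_subset _ _

theorem coordSum_indVec_of_mem_tightBases (hA : A ∈ tightBases M L) :
    coordSum L (indVec A) = finsetRank M L := by
  rw [coordSum_indVec, hA.2]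

theorem coordSum_indVec_lt (hA : A ∈ bases M) (hAL : A ∉ tightBases M L) :
    coordSum L (indVec A) < finsetRank M L := by
  rw [coordSum_indVec, Nat.cast_lt]
  exact (card_inter_le_finsetRank hA L).lt_of_ne fun h => hAL ⟨hA, h⟩

theorem vectorSpan_tightBases_le : vectorSpan ℝ (indVec '' tightBases M L) ≤
    vectorSpan ℝ (vertices M) ⊓ LinearMap.ker (coordSum L).toLinearMap :=
  le_inf (vectorSpan_mono ℝ (image_mono tightBases_subset_bases))
    (vectorSpan_le_ker_of_forall_apply_eq
      (forall_mem_image.2 fun _ => coordSum_indVec_of_mem_tightBases))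

variable [M.Finite]

/-- `L` lies in the component of `x`, and `∑ i ∈ L, y i ≤ finsetRank M L` cuts out a facet of the
base polytope that is not a facet of the hypersimplex. -/
structure IsFacetSet (M : Matroid α) [M.Finite] (x : α) (L : Finset α) : Prop where
  subset : L ⊆ component M x
  finsetRank_lt_card : finsetRank M L < #L
  finsetRank_lt : finsetRank M L < finsetRank M (component M x)
  tightBases_nonempty : (tightBases M L).Nonempty
  vectorSpan_eq : vectorSpan ℝ (indVec '' tightBases M L) =
    vectorSpan ℝ (vertices M) ⊓ LinearMap.ker (coordSum L).toLinearMap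

/-- If the face of `L` is not a facet, then the hyperplane supporting it can be rotated about it
until it hits a further vertex. -/
theorem exists_weight_of_vectorSpan_ne (hA : A ∈ tightBases M L) (he : e ∉ L) (hf : f ∈ L)
    (hne : vectorSpan ℝ (indVec '' tightBases M L) ≠
      vectorSpan ℝ (vertices M) ⊓ LinearMap.ker (coordSum L).toLinearMap) :
    ∃ c : (α → ℝ) →ₗ[ℝ] ℝ, c (Pi.single e 1) < c (Pi.single f 1) ∧
      (∀ B ∈ bases M, c (indVec B) ≤ c (indVec A)) ∧
      (∀ B ∈ tightBases M L, c (indVec B) = c (indVec A)) ∧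
      ∃ B ∈ bases M, B ∉ tightBases M L ∧ c (indVec B) = c (indVec A) := by
  obtain ⟨b, hbtight, hbef, w, hw, hbw⟩ := exists_dual_apply_eq_of_lt
    (lt_of_le_of_ne vectorSpan_tightBases_le hne) (u := Pi.single f 1 - Pi.single e 1)
    (by simp [coordSum_single, he, hf]) (mem_image_of_mem _ hA)
  rw [map_sub, sub_eq_zero] at hbef
  rw [forall_mem_image] at hbtight
  have hmax : ∀ v ∈ vertices M, (coordSum L).toLinearMap v ≤ coordSum L (indVec A) := by
    rintro _ ⟨B, hB, rfl⟩
    rw [coordSum_indVec_of_mem_tightBases hA, ContinuousLinearMap.coe_coe, coordSum_indVec]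
    exact_mod_cast card_inter_le_finsetRank hB L
  obtain ⟨t, hct, _, ⟨B, hB, rfl⟩, hbB, hcB⟩ := exists_tilt ((finite_bases M).image _) hmax hw hbw
  refine ⟨(coordSum L).toLinearMap + t • b, ?_, forall_mem_image.1 hct, fun D hD => ?_,
    B, hB, fun hBt => hbB.ne' (hbtight hBt), hcB⟩
  · simp [coordSum_single, he, hf, hbef]
  · simp [coordSum_indVec_of_mem_tightBases hD, coordSum_indVec_of_mem_tightBases hA,
      hbtight hD]

theorem exists_tightBases_ssubset (hA : A ∈ tightBases M L) (he : e ∉ L) (hf : f ∈ L)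
    (hfC : f ∈ component M x)
    (hne : vectorSpan ℝ (indVec '' tightBases M L) ≠
      vectorSpan ℝ (vertices M) ⊓ LinearMap.ker (coordSum L).toLinearMap) :
    ∃ L' ⊆ component M x, e ∉ L' ∧ f ∈ L' ∧ tightBases M L ⊂ tightBases M L' := by
  obtain ⟨c, hcef, hmax, htight, B, hB, hBL, hcB⟩ :=
    exists_weight_of_vectorSpan_ne hA he hf hne
  have hc (D : Finset α) : c (indVec D) = ∑ i ∈ D, c (Pi.single i 1) := by
    rw [indVec_eq_sum_single, map_sum]
  let L' := {g ∈ component M x | c (Pi.single e 1) < c (Pi.single g 1)}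
  have hL' : ∀ D ∈ bases M, c (indVec D) = c (indVec A) → D ∈ tightBases M L' :=
    fun D hD hDA => ⟨hD, card_inter_superlevel_eq_finsetRank hD
      (fun B hB => hc B ▸ hc D ▸ hDA ▸ hmax B hB) _⟩
  exact ⟨L', Finset.filter_subset _ _, by simp [L'], by simp [L', hfC, hcef],
    fun D hD => hL' D hD.1 (htight D hD), fun h => hBL (h (hL' B hB hcB))⟩

theorem exists_isFacetSet (hA : A ∈ bases M) (he : e ∈ A) (heC : e ∈ component M x)
    (hf : f ∉ A) (hfC : f ∈ component M x) (hex : insert f (A.erase e) ∉ bases M) :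
    ∃ L, IsFacetSet M x L ∧ A ∈ tightBases M L ∧ f ∈ L ∧ e ∉ L := by
  let candidates := {L | L ⊆ component M x ∧ A ∈ tightBases M L ∧ f ∈ L ∧ e ∉ L}
  have hfinite : candidates.Finite := (component M x).powerset.finite_toSet.subset
    fun L hL => Finset.mem_powerset.2 hL.1
  obtain ⟨L₀, hL₀, htight, hfL₀, heL₀⟩ := exists_card_inter_eq_finsetRank hA he hf hfC hex
  obtain ⟨L, ⟨hL, hAL, hfL, heL⟩, hmax⟩ := hfinite.exists_maximalFor (tightBases M) _
    ⟨L₀, hL₀, ⟨hA, htight⟩, hfL₀, heL₀⟩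
  refine ⟨L, ⟨hL, ?_, ?_, ⟨A, hAL⟩, ?_⟩, hAL, hfL, heL⟩
  · rw [← hAL.2]
    exact Finset.card_lt_card ⟨Finset.inter_subset_right,
      fun h => hf (Finset.mem_inter.1 (h hfL)).1⟩
  · rw [← hAL.2, ← card_inter_component hA]
    exact Finset.card_lt_card ⟨Finset.inter_subset_inter_left hL,
      fun h => heL (Finset.mem_inter.1 (h (Finset.mem_inter.2 ⟨he, heC⟩))).2⟩
  · by_contra hne
    obtain ⟨L', hL', heL', hfL', hlt⟩ := exists_tightBases_ssubset hAL heL hfL hfC hne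
    exact hlt.2 (hmax ⟨hL', hlt.1 hAL, hfL', heL'⟩ hlt.1)

end FacetSets

section Faces

theorem finrank_inf_ker_add_one {K E : Type*} [Field K] [AddCommGroup E] [Module K E]
    {V : Submodule K E} [FiniteDimensional K V] {φ : E →ₗ[K] K} (hφ : ¬ V ≤ LinearMap.ker φ) :
    Module.finrank K (V ⊓ LinearMap.ker φ : Submodule K E) + 1 = Module.finrank K V := by
  have hne : φ.domRestrict V ≠ 0 := fun h =>
    hφ fun v hv => LinearMap.congr_fun h ⟨v, hv⟩
  rw [← Module.Dual.finrank_ker_add_one_of_ne_zero hne, LinearMap.ker_domRestrict,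
    ← Submodule.map_comap_subtype, Submodule.finrank_map_subtype_eq]

variable {α : Type*} {M : Matroid α} {A B L : Finset α} {x : α} {y : α → ℝ}

/-- The face of the base polytope on which the coordinate sum over `L` is largest. -/
def face (M : Matroid α) (L : Finset α) : Set (α → ℝ) :=
  {y ∈ basePolytope M | coordSum L y = finsetRank M L}

theorem basePolytope_eq_convexHull (M : Matroid α) [M.Finite] :
    basePolytope M = convexHull ℝ (vertices M) := by
  refine congrArg _ (Set.ext fun v => ⟨?_, ?_⟩)
  · rintro ⟨B, hB, rfl⟩
    obtain ⟨A, hA, rfl⟩ := exists_mem_bases_coe_eq hB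
    exact indVec_mem_vertices hA
  · rintro ⟨A, hA, rfl⟩
    exact ⟨A, hA, rfl⟩

theorem affineSpan_basePolytope (M : Matroid α) [M.Finite] :
    affineSpan ℝ (basePolytope M) = affineSpan ℝ (vertices M) := by
  rw [basePolytope_eq_convexHull, affineSpan_convexHull]

theorem vectorSpan_basePolytope (M : Matroid α) [M.Finite] :
    vectorSpan ℝ (basePolytope M) = vectorSpan ℝ (vertices M) := by
  rw [← direction_affineSpan, affineSpan_basePolytope, direction_affineSpan]

variable [M.Finite]

theorem coordSum_le_finsetRank (hy : y ∈ basePolytope M) : coordSum L y ≤ finsetRank M L := by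
  classical
  rw [basePolytope_eq_convexHull] at hy
  refine convexHull_min ?_ (convex_halfSpace_le (coordSum L).toLinearMap.isLinear _) hy
  rintro _ ⟨B, hB, rfl⟩
  simpa [coordSum_indVec] using card_inter_le_finsetRank hB L

variable [DecidableEq α]

theorem indVec_mem_face (hA : A ∈ tightBases M L) : indVec A ∈ face M L :=
  ⟨basePolytope_eq_convexHull M ▸ subset_convexHull ℝ _ (indVec_mem_vertices hA.1),
    coordSum_indVec_of_mem_tightBases hA⟩

theorem isExposed_face (hA : A ∈ tightBases M L) : IsExposed ℝ (basePolytope M) (face M L) := by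
  refine fun _ => ⟨coordSum L, Set.ext fun y => ⟨?_, ?_⟩⟩
  · rintro ⟨hy, hyL⟩
    exact ⟨hy, fun z hz => (coordSum_le_finsetRank hz).trans_eq hyL.symm⟩
  · rintro ⟨hy, hmax⟩
    have hAL := indVec_mem_face hA
    exact ⟨hy, (coordSum_le_finsetRank hy).antisymm (hAL.2 ▸ hmax _ hAL.1)⟩

theorem IsFacetSet.vectorSpan_face (hL : IsFacetSet M x L) :
    vectorSpan ℝ (face M L) =
      vectorSpan ℝ (vertices M) ⊓ LinearMap.ker (coordSum L).toLinearMap := by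
  refine le_antisymm (le_inf ?_ (vectorSpan_le_ker_of_forall_apply_eq fun _ hy => hy.2)) ?_
  · rw [← vectorSpan_basePolytope]
    exact vectorSpan_mono ℝ (sep_subset _ _)
  · rw [← hL.vectorSpan_eq]
    exact vectorSpan_mono ℝ (image_subset_iff.2 fun _ => indVec_mem_face)

theorem IsFacetSet.isFacet (hL : IsFacetSet M x L) (hB : B ∈ bases M) (hBL : B ∉ tightBases M L) :
    IsFacet (basePolytope M) (face M L) := by
  obtain ⟨A, hA⟩ := hL.tightBases_nonempty
  refine ⟨⟨_, indVec_mem_face hA⟩, isExposed_face hA, ?_⟩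
  have : FiniteDimensional ℝ (vectorSpan ℝ (vertices M)) :=
    finiteDimensional_vectorSpan_of_finite ℝ ((finite_bases M).image _)
  rw [hL.vectorSpan_face, vectorSpan_basePolytope]
  refine finrank_inf_ker_add_one fun hle => hBL ⟨hB, ?_⟩
  have hBA := hle (vsub_mem_vectorSpan ℝ (indVec_mem_vertices hB) (indVec_mem_vertices hA.1))
  rw [vsub_eq_sub, LinearMap.mem_ker, map_sub, sub_eq_zero] at hBA
  have hBL : (#(B ∩ L) : ℝ) = finsetRank M L := by
    rw [← coordSum_indVec, ← coordSum_indVec_of_mem_tightBases hA]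
    exact hBA
  exact_mod_cast hBL

theorem IsFacetSet.mem_affineSpan_face (hL : IsFacetSet M x L)
    (hy : y ∈ affineSpan ℝ (vertices M)) (hyL : coordSum L y = finsetRank M L) :
    y ∈ affineSpan ℝ (face M L) := by
  obtain ⟨A, hA⟩ := hL.tightBases_nonempty
  rw [← AffineSubspace.vsub_right_mem_direction_iff_mem
    (subset_affineSpan ℝ _ (indVec_mem_face hA)), direction_affineSpan, hL.vectorSpan_face]
  refine ⟨?_, by simp [hyL, coordSum_indVec_of_mem_tightBases hA]⟩
  rw [SetLike.mem_coe, ← direction_affineSpan]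
  exact AffineSubspace.vsub_mem_direction hy
    (subset_affineSpan ℝ _ (indVec_mem_vertices hA.1))

end Faces

section DistinctFaces

variable {α : Type*} [DecidableEq α]

theorem eq_or_eq_sdiff_of_mem_iff {C L₁ L₂ : Finset α} (h₁ : L₁ ⊆ C) (h₂ : L₂ ⊂ C)
    (hne : L₂.Nonempty)
    (hmem : ∀ a ∈ C, ∀ b ∈ C, (a ∈ L₁ ↔ b ∈ L₁) → (a ∈ L₂ ↔ b ∈ L₂)) :
    L₂ = L₁ ∨ L₂ = C \ L₁ := by
  obtain ⟨p, hp⟩ := hne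
  obtain ⟨q, hqC, hq⟩ := Finset.exists_of_ssubset h₂
  have hpC := h₂.1 hp
  have hpq : ¬(p ∈ L₁ ↔ q ∈ L₁) := fun h => hq ((hmem p hpC q hqC h).1 hp)
  have hmem' : ∀ y ∈ C, y ∈ L₂ ↔ (y ∈ L₁ ↔ p ∈ L₁) := fun y hy =>
    ⟨fun hyL => by_contra fun h => hq ((hmem y hy q hqC (by tauto)).1 hyL),
      fun h => (hmem y hy p hpC h).2 hp⟩
  by_cases hp₁ : p ∈ L₁
  · refine Or.inl (Finset.ext fun y => ⟨fun hy => ((hmem' y (h₂.1 hy)).1 hy).2 hp₁, fun hy => ?_⟩)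
    simp [hmem' y (h₁ hy), hy, hp₁]
  · refine Or.inr (Finset.ext fun y => ⟨fun hy => ?_, fun hy => ?_⟩)
    · have := (hmem' y (h₂.1 hy)).1 hy
      exact Finset.mem_sdiff.2 ⟨h₂.1 hy, by tauto⟩
    · rw [Finset.mem_sdiff] at hy
      simp [hmem' y hy.1, hy.2, hp₁]

variable {M : Matroid α} [M.Finite] {L L₁ L₂ : Finset α} {x : α}

theorem IsFacetSet.ssubset (hL : IsFacetSet M x L) : L ⊂ component M x :=
  hL.subset.ssubset_of_ne fun h => hL.finsetRank_lt.ne (by rw [h])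

theorem IsFacetSet.mem_iff_mem_of_tightBases_subset (h₁ : IsFacetSet M x L₁)
    (h₂ : IsFacetSet M x L₂) (hsub : tightBases M L₁ ⊆ tightBases M L₂) {a b : α}
    (ha : a ∈ component M x) (hb : b ∈ component M x) (hab : a ∈ L₁ ↔ b ∈ L₁) :
    a ∈ L₂ ↔ b ∈ L₂ := by
  have hle := vectorSpan_mono ℝ (image_mono (f := indVec) hsub)
  rw [h₁.vectorSpan_eq, h₂.vectorSpan_eq] at hle
  have hker : coordSum L₂ (Pi.single b 1 - Pi.single a 1) = 0 :=
    (hle ⟨single_sub_single_mem_vectorSpan ha hb, by simp [coordSum_single, hab]⟩).2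
  simp only [map_sub, coordSum_single, sub_eq_zero] at hker
  by_cases haL : a ∈ L₂ <;> by_cases hbL : b ∈ L₂ <;> simp_all

theorem IsFacetSet.exists_mem_tightBases_notMem (h₁ : IsFacetSet M x L₁)
    (h₂ : IsFacetSet M x L₂) (hne : L₁ ≠ L₂)
    (hlt : finsetRank M L₁ + finsetRank M L₂ < #(L₁ ∩ L₂) + finsetRank M (component M x)) :
    ∃ B ∈ tightBases M L₁, B ∉ tightBases M L₂ := by
  by_contra! hsub
  obtain ⟨A, hA, -⟩ := h₁.tightBases_nonempty
  rcases eq_or_eq_sdiff_of_mem_iff h₁.subset h₂.ssubset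
    (Finset.card_pos.1 (Nat.zero_lt_of_lt h₂.finsetRank_lt_card))
    (fun a ha b hb => h₁.mem_iff_mem_of_tightBases_subset h₂ hsub ha hb) with rfl | rfl
  · exact hne rfl
  · have hcard : #(A ∩ L₁) + #(A ∩ (component M x \ L₁)) = #(A ∩ component M x) := by
      rw [← Finset.card_union_of_disjoint, ← Finset.inter_union_distrib_left,
        Finset.union_sdiff_of_subset h₁.subset]
      exact Finset.disjoint_sdiff.mono Finset.inter_subset_right Finset.inter_subset_right
    have hle₁ := card_inter_le_finsetRank hA L₁
    have hle₂ := card_inter_le_finsetRank hA (component M x \ L₁)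
    rw [Finset.inter_sdiff_self, Finset.card_empty] at hlt
    rw [card_inter_component hA] at hcard
    omega

end DistinctFaces

section AmbientPolytope

theorem mem_intrinsicInterior_of_isOpen {E : Type*} [AddCommGroup E] [Module ℝ E]
    [TopologicalSpace E] {s U : Set E} {y : E} (hU : IsOpen U)
    (hsub : (affineSpan ℝ s : Set E) ∩ U ⊆ s)
    (hy : y ∈ affineSpan ℝ s) (hyU : y ∈ U) : y ∈ intrinsicInterior ℝ s :=
  mem_intrinsicInterior.2 ⟨⟨y, hy⟩, interior_maximal (fun (z : affineSpan ℝ s) hz => hsub ⟨z.2, hz⟩)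
    (hU.preimage continuous_subtype_val) hyU, rfl⟩

/-- The witness is the barycenter of `s`. -/
theorem exists_mem_convexHull_forall_lt {E : Type*} [AddCommGroup E] [Module ℝ E] {s : Set E}
    (hs : s.Finite) (hne : s.Nonempty) :
    ∃ b ∈ convexHull ℝ s, ∀ (ℓ : E →ₗ[ℝ] ℝ) (c : ℝ), (∀ v ∈ s, ℓ v ≤ c) →
      (∃ v ∈ s, ℓ v < c) → ℓ b < c := by
  lift s to Finset E using hs
  have hcard : (0 : ℝ) < #s := by exact_mod_cast Finset.card_pos.2 (Finset.coe_nonempty.1 hne)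
  refine ⟨s.centerMass (fun _ => (1 : ℝ)) id,
    s.centerMass_id_mem_convexHull (fun _ _ => zero_le_one) (by simpa using hcard),
    fun ℓ c hle hlt => ?_⟩
  have hsum : ∑ v ∈ s, ℓ v < #s * c := by
    simpa only [Finset.sum_const, nsmul_eq_mul] using Finset.sum_lt_sum hle hlt
  simpa [Finset.centerMass, inv_mul_lt_iff₀ hcard] using hsum

variable {α : Type*} {M : Matroid α} {S : Finset α} {y z : α → ℝ}

/-- A relatively open part of the ambient polytope: a bound `0` or `1` on a coordinate is strict,
unless it is an equality throughout the affine hull of the base polytope. -/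
def openSlice (M : Matroid α) : Set (α → ℝ) :=
  {y | y ∈ affineSpan ℝ (vertices M) ∧ ∀ i ∈ M.E,
    ((∀ v ∈ vertices M, v i = 0) ∨ 0 < y i) ∧ ((∀ v ∈ vertices M, v i = 1) ∨ y i < 1)}

theorem apply_eq_of_forall_vertices {i : α} {c : ℝ} (h : ∀ v ∈ vertices M, v i = c)
    (hy : y ∈ affineSpan ℝ (vertices M)) : y i = c :=
  apply_eq_of_mem_affineSpan (ℓ := LinearMap.proj i) h hy

theorem apply_eq_zero_of_notMem_ground (hy : y ∈ affineSpan ℝ (vertices M)) {i : α}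
    (hi : i ∉ M.E) : y i = 0 := by
  classical
  refine apply_eq_of_forall_vertices (forall_mem_image.2 fun B hB => ?_) hy
  rw [indVec_apply, if_neg fun h : i ∈ B => hi (Matroid.IsBase.subset_ground hB h)]

variable [M.Finite]

theorem finsum_mem_ground_eq (hy : y ∈ affineSpan ℝ (vertices M)) :
    ∑ᶠ i ∈ M.E, y i = M.eRank.toNat := by
  classical
  rw [finsum_mem_eq_finite_toFinset_sum _ M.ground_finite, ← coordSum_apply]
  refine apply_eq_of_mem_affineSpan (ℓ := (coordSum _).toLinearMap)
    (forall_mem_image.2 fun B hB => ?_) hy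
  have hBE : B ⊆ M.ground_finite.toFinset := fun i hi =>
    M.ground_finite.mem_toFinset.2 (Matroid.IsBase.subset_ground hB hi)
  rw [ContinuousLinearMap.coe_coe, coordSum_indVec, Finset.inter_eq_left.2 hBE,
    ← Matroid.IsBase.encard_eq_eRank hB, Set.encard_coe_eq_coe_finsetCard, ENat.toNat_natCast]

theorem mem_ambientPolytope_iff :
    y ∈ ambientPolytope M ↔ y ∈ affineSpan ℝ (vertices M) ∧ ∀ i, 0 ≤ y i ∧ y i ≤ 1 := by
  rw [ambientPolytope, affineSpan_basePolytope]
  exact ⟨fun hy => ⟨hy.2, hy.1.1⟩, fun hy => ⟨⟨hy.2, fun _ => apply_eq_zero_of_notMem_ground hy.1,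
    finsum_mem_ground_eq hy.1⟩, hy.1⟩⟩

theorem indVec_mem_ambientPolytope (hS : indVec S ∈ affineSpan ℝ (vertices M)) :
    indVec S ∈ ambientPolytope M := by
  classical
  refine mem_ambientPolytope_iff.2 ⟨hS, fun i => ?_⟩
  rw [indVec_apply]
  split_ifs <;> simp

theorem indVec_mem_ambientPolytope_of_mem_bases {B : Finset α} (hB : B ∈ bases M) :
    indVec B ∈ ambientPolytope M :=
  indVec_mem_ambientPolytope (subset_affineSpan ℝ _ (indVec_mem_vertices hB))

theorem convex_ambientPolytope : Convex ℝ (ambientPolytope M) := by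
  have : ambientPolytope M = (affineSpan ℝ (vertices M) : Set (α → ℝ)) ∩ Icc 0 1 := by
    ext y
    simp [mem_ambientPolytope_iff, Pi.le_def, forall_and]
  rw [this]
  exact (AffineSubspace.convex _).inter (convex_Icc 0 1)

theorem openSlice_subset_ambientPolytope : openSlice M ⊆ ambientPolytope M := by
  refine fun y hy => mem_ambientPolytope_iff.2 ⟨hy.1, fun i => ?_⟩
  by_cases hi : i ∈ M.E
  · rcases hy.2 i hi with ⟨h₀ | h₀, h₁ | h₁⟩
    · simp [apply_eq_of_forall_vertices h₀ hy.1]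
    · simp [apply_eq_of_forall_vertices h₀ hy.1]
    · simp [apply_eq_of_forall_vertices h₁ hy.1]
    · exact ⟨h₀.le, h₁.le⟩
  · simp [apply_eq_zero_of_notMem_ground hy.1 hi]

theorem openSegment_subset_openSlice (hy : y ∈ openSlice M) (hz : z ∈ ambientPolytope M) :
    openSegment ℝ y z ⊆ openSlice M := by
  rintro _ ⟨s, t, hs, ht, hst, rfl⟩
  rw [mem_ambientPolytope_iff] at hz
  refine ⟨AffineSubspace.convex _ hy.1 hz.1 hs.le ht.le hst, fun i hi => ?_⟩
  simp only [Pi.add_apply, Pi.smul_apply, smul_eq_mul]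
  obtain ⟨hz₀, hz₁⟩ := hz.2 i
  refine ⟨(hy.2 i hi).1.imp_right fun h₀ => ?_, (hy.2 i hi).2.imp_right fun h₁ => ?_⟩
  · positivity
  · nlinarith

theorem openSlice_subset_intrinsicInterior :
    openSlice M ⊆ intrinsicInterior ℝ (ambientPolytope M) := by
  refine fun y hy => mem_intrinsicInterior_of_isOpen (U := ⋂ i ∈ M.E,
    {z : α → ℝ |
      ((∀ v ∈ vertices M, v i = 0) ∨ 0 < z i) ∧ ((∀ v ∈ vertices M, v i = 1) ∨ z i < 1)})
    ?_ ?_ (subset_affineSpan ℝ _ (openSlice_subset_ambientPolytope hy))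
    (by exact mem_iInter₂.2 hy.2)
  · refine M.ground_finite.isOpen_biInter fun i _ => ?_
    exact (isOpen_const.union (isOpen_lt continuous_const (continuous_apply i))).inter
      (isOpen_const.union (isOpen_lt (continuous_apply i) continuous_const))
  · have hle : affineSpan ℝ (ambientPolytope M) ≤ affineSpan ℝ (vertices M) :=
      affineSpan_le.2 fun y hy => (mem_ambientPolytope_iff.1 hy).1
    exact fun z hz => openSlice_subset_ambientPolytope ⟨hle hz.1, mem_iInter₂.1 hz.2⟩

theorem exists_mem_openSlice_forall_lt [DecidableEq α] (M : Matroid α) [M.Finite] :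
    ∃ b ∈ openSlice M, ∀ L, (∃ B ∈ bases M, B ∉ tightBases M L) →
      coordSum L b < finsetRank M L := by
  have hvertices : (vertices M).Nonempty := by
    obtain ⟨_, hB⟩ := M.exists_isBase
    obtain ⟨B, hB, -⟩ := exists_mem_bases_coe_eq hB
    exact ⟨_, indVec_mem_vertices hB⟩
  obtain ⟨b, hb, hlt⟩ := exists_mem_convexHull_forall_lt ((finite_bases M).image indVec) hvertices
  have hunit : ∀ v ∈ vertices M, ∀ i, 0 ≤ v i ∧ v i ≤ 1 := forall_mem_image.2 fun B hB =>
    (mem_ambientPolytope_iff.1 (indVec_mem_ambientPolytope_of_mem_bases hB)).2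
  refine ⟨b, ⟨convexHull_subset_affineSpan _ hb, fun i _ => ⟨?_, ?_⟩⟩, fun L hL => ?_⟩
  · refine or_iff_not_imp_left.2 fun h => ?_
    push Not at h
    obtain ⟨v, hv, hvi⟩ := h
    simpa using hlt (-LinearMap.proj i) 0 (fun w hw => by simpa using (hunit w hw i).1)
      ⟨v, hv, by simpa using lt_of_le_of_ne (hunit v hv i).1 hvi.symm⟩
  · refine or_iff_not_imp_left.2 fun h => ?_
    push Not at h
    obtain ⟨v, hv, hvi⟩ := h
    exact hlt (LinearMap.proj i) 1 (fun w hw => (hunit w hw i).2)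
      ⟨v, hv, lt_of_le_of_ne (hunit v hv i).2 hvi⟩
  · obtain ⟨B, hB, hBL⟩ := hL
    refine hlt (coordSum L).toLinearMap _ (forall_mem_image.2 fun A hA => ?_)
      ⟨_, indVec_mem_vertices hB, ?_⟩
    · simpa [coordSum_indVec] using card_inter_le_finsetRank hA L
    · exact coordSum_indVec_lt hB hBL

end AmbientPolytope

section CommonLevel

variable {E : Type*} [AddCommGroup E] [Module ℝ E] {f g : E →ₗ[ℝ] ℝ} {P I : Set E}
  {b u v w x y z : E} {c d : ℝ}

theorem apply_mem_Ioo_of_mem_openSegment (hxy : f x < f y) (hw : w ∈ openSegment ℝ x y) :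
    f w ∈ Ioo (f x) (f y) := by
  rw [← openSegment_eq_Ioo hxy]
  exact image_openSegment ℝ f.toAffineMap x y ▸ mem_image_of_mem f hw

theorem exists_mem_openSegment_apply_eq (hx : f x < c) (hy : c < f y) :
    ∃ w ∈ openSegment ℝ x y, f w = c := by
  have hc : c ∈ f.toAffineMap '' openSegment ℝ x y := by
    rw [image_openSegment]
    exact openSegment_eq_Ioo (hx.trans hy) ▸ ⟨hx, hy⟩
  exact hc

theorem apply_eq_of_mem_openSegment (hx : f x = c) (hy : f y = c) (hw : w ∈ openSegment ℝ x y) :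
    f w = c :=
  (convex_hyperplane f.isLinear c).openSegment_subset hx hy hw

theorem exists_mem_lt_and_lt (hP : Convex ℝ P) (hx : x ∈ P) (hxf : c < f x)
    (hxfg : c + d < f x + g x) (hy : y ∈ P) (hyg : d < g y) (hyfg : c + d < f y + g y) :
    ∃ z ∈ P, c < f z ∧ d < g z := by
  by_cases hxg : d < g x
  · exact ⟨x, hx, hxf, hxg⟩
  by_cases hyf : c < f y
  · exact ⟨y, hy, hyf, hyg⟩
  obtain ⟨z, hz, hzfg⟩ := exists_mem_openSegment_apply_eq (f := f - g) (x := y) (y := x)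
    (c := c - d) (by rw [LinearMap.sub_apply]; linarith) (by rw [LinearMap.sub_apply]; linarith)
  have hzsum : c + d < (f + g) z :=
    (convex_halfSpace_gt (f + g).isLinear (c + d)).openSegment_subset hyfg hxfg hz
  rw [LinearMap.sub_apply] at hzfg
  rw [LinearMap.add_apply] at hzsum
  exact ⟨z, hP.openSegment_subset hy hx hz, by linarith, by linarith⟩

/-- In the plane of the values of `(f, g)`, where `(c, d)` is the origin, move from the left
half-plane towards the positive quadrant until the vertical axis is hit, and then to the origin,
either directly or by way of the horizontal axis. -/
theorem exists_apply_eq_and_apply_eq (hI : ∀ ⦃x⦄, x ∈ I → ∀ ⦃y⦄, y ∈ P → openSegment ℝ x y ⊆ I)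
    (hb : b ∈ I) (hbf : f b < c) (hz : z ∈ P) (hzf : c < f z) (hzg : d < g z)
    (hu : u ∈ P) (huf : f u = c) (hug : g u < d) (hv : v ∈ P) (hvf : f v < c) (hvg : g v = d) :
    ∃ y ∈ I, f y = c ∧ g y = d := by
  obtain ⟨w, hw, hwf⟩ := exists_mem_openSegment_apply_eq hbf hzf
  have hwI := hI hb hz hw
  rcases lt_trichotomy (g w) d with hwg | hwg | hwg
  · obtain ⟨w', hw', hwg'⟩ := exists_mem_openSegment_apply_eq hwg hzg
    have hwf' : c < f w' := hwf ▸ (apply_mem_Ioo_of_mem_openSegment (hwf ▸ hzf) hw').1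
    obtain ⟨y, hy, hyf⟩ := exists_mem_openSegment_apply_eq hvf hwf'
    rw [openSegment_symm] at hy
    exact ⟨y, hI (hI hwI hz hw') hv hy, hyf, apply_eq_of_mem_openSegment hwg' hvg hy⟩
  · exact ⟨w, hwI, hwf, hwg⟩
  · obtain ⟨y, hy, hyg⟩ := exists_mem_openSegment_apply_eq hug hwg
    rw [openSegment_symm] at hy
    exact ⟨y, hI hwI hu hy, apply_eq_of_mem_openSegment hwf huf hy, hyg⟩

end CommonLevel

section SplitMatroids

variable {α : Type*}

theorem exists_card_eq_comparable {I L U C : Finset α} {k : ℕ} (hIL : I ⊆ L) (hLU : L ⊆ U)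
    (hUC : U ⊆ C) (hk : k ≤ #C) :
    ∃ Y ⊆ C, #Y = k ∧ (Y ⊆ I ∨ I ⊆ Y) ∧ (Y ⊆ L ∨ L ⊆ Y) ∧ (Y ⊆ U ∨ U ⊆ Y) := by
  rcases le_total k #I with hkI | hkI
  · obtain ⟨Y, hYI, hY⟩ := Finset.exists_subset_card_eq hkI
    exact ⟨Y, hYI.trans (hIL.trans (hLU.trans hUC)), hY, .inl hYI, .inl (hYI.trans hIL),
      .inl (hYI.trans (hIL.trans hLU))⟩
  rcases le_total k #L with hkL | hkL
  · obtain ⟨Y, hIY, hYL, hY⟩ := Finset.exists_subsuperset_card_eq hIL hkI hkL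
    exact ⟨Y, hYL.trans (hLU.trans hUC), hY, .inr hIY, .inl hYL, .inl (hYL.trans hLU)⟩
  rcases le_total k #U with hkU | hkU
  · obtain ⟨Y, hLY, hYU, hY⟩ := Finset.exists_subsuperset_card_eq hLU hkL hkU
    exact ⟨Y, hYU.trans hUC, hY, .inr (hIL.trans hLY), .inr hLY, .inl hYU⟩
  · obtain ⟨Y, hUY, hYC, hY⟩ := Finset.exists_subsuperset_card_eq hUC hkU hk
    exact ⟨Y, hYC, hY, .inr (hIL.trans (hLU.trans hUY)), .inr (hLU.trans hUY), .inr hUY⟩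

variable [DecidableEq α]

theorem card_inter_eq_min {S Y : Finset α} (h : Y ⊆ S ∨ S ⊆ Y) : #(Y ∩ S) = min #Y #S := by
  rcases h with h | h
  · rw [Finset.inter_eq_left.2 h, min_eq_left (Finset.card_le_card h)]
  · rw [Finset.inter_eq_right.2 h, min_eq_right (Finset.card_le_card h)]

theorem exists_card_inter_lt {C L₁ L₂ : Finset α} {k r₁ r₂ : ℕ} (h₁ : L₁ ⊆ C) (h₂ : L₂ ⊆ C)
    (hk : k ≤ #C) (hr₁ : r₁ < #L₁) (hr₂ : r₂ < #L₂) (hk₁ : r₁ < k) (hk₂ : r₂ < k)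
    (h : r₁ + r₂ < #(L₁ ∩ L₂) + k) :
    ∃ Y ⊆ C, #Y = k ∧ r₁ < #(Y ∩ L₁) ∧ r₁ + r₂ < #(Y ∩ L₁) + #(Y ∩ L₂) := by
  obtain ⟨Y, hYC, hY, hinter, hL, hunion⟩ := exists_card_eq_comparable
    Finset.inter_subset_left Finset.subset_union_left (Finset.union_subset h₁ h₂) hk
  have hYcard := Finset.card_union_add_card_inter (Y ∩ L₁) (Y ∩ L₂)
  rw [← Finset.inter_union_distrib_left, ← Finset.inter_inter_distrib_left,
    card_inter_eq_min hinter, card_inter_eq_min hunion, hY] at hYcard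
  have hLcard := Finset.card_union_add_card_inter L₁ L₂
  have hle : #(L₁ ∩ L₂) ≤ #(L₁ ∪ L₂) := Finset.card_le_card Finset.inter_subset_union
  refine ⟨Y, hYC, hY, ?_, by omega⟩
  rw [card_inter_eq_min hL, hY]
  exact lt_min hk₁ hr₁

variable {M : Matroid α} [M.Finite] {A Y L₁ L₂ : Finset α} {x : α}

theorem exists_mem_ambientPolytope_coordSum_eq (hA : A ∈ bases M) (hY : Y ⊆ component M x)
    (hcard : #Y = finsetRank M (component M x)) :
    ∃ y ∈ ambientPolytope M, ∀ L ⊆ component M x, coordSum L y = #(Y ∩ L) := by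
  refine ⟨indVec (Y ∪ A \ component M x), indVec_mem_ambientPolytope ?_, fun L hL => ?_⟩
  · have hsub : indVec (Y ∪ A \ component M x) - indVec A =
        indVec Y - indVec (A ∩ component M x) := by
      ext i
      have hYi := @hY i
      simp only [Pi.sub_apply, indVec_apply, Finset.mem_union, Finset.mem_sdiff, Finset.mem_inter]
      by_cases i ∈ Y <;> by_cases i ∈ A <;> by_cases i ∈ component M x <;> simp_all
    rw [← AffineSubspace.vsub_right_mem_direction_iff_mem
      (subset_affineSpan ℝ _ (indVec_mem_vertices hA)), direction_affineSpan, vsub_eq_sub, hsub]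
    exact indVec_sub_indVec_mem (fun e he f hf => single_sub_single_mem_vectorSpan he hf) hY
      Finset.inter_subset_right (hcard.trans (card_inter_component hA).symm)
  · have hdisj : A \ component M x ∩ L = ∅ :=
      Finset.disjoint_iff_inter_eq_empty.1 (Finset.sdiff_disjoint.mono_right hL)
    rw [coordSum_indVec, Finset.union_inter_distrib_right, hdisj, Finset.union_empty]

theorem IsFacetSet.exists_mem_ambientPolytope_lt (h₁ : IsFacetSet M x L₁)
    (h₂ : IsFacetSet M x L₂)
    (hlt : finsetRank M L₁ + finsetRank M L₂ < #(L₁ ∩ L₂) + finsetRank M (component M x)) :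
    ∃ y ∈ ambientPolytope M, (finsetRank M L₁ : ℝ) < coordSum L₁ y ∧
      (finsetRank M L₁ + finsetRank M L₂ : ℝ) < coordSum L₁ y + coordSum L₂ y := by
  obtain ⟨A, hA, -⟩ := h₁.tightBases_nonempty
  have hk : finsetRank M (component M x) ≤ #(component M x) := by
    rw [← card_inter_component hA]
    exact Finset.card_le_card Finset.inter_subset_right
  obtain ⟨Y, hY, hcard, hlt₁, hlt₂⟩ := exists_card_inter_lt h₁.subset h₂.subset hk
    h₁.finsetRank_lt_card h₂.finsetRank_lt_card h₁.finsetRank_lt h₂.finsetRank_lt hlt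
  obtain ⟨y, hy, hyL⟩ := exists_mem_ambientPolytope_coordSum_eq hA hY hcard
  refine ⟨y, hy, ?_, ?_⟩
  · rw [hyL _ h₁.subset]
    exact_mod_cast hlt₁
  · rw [hyL _ h₁.subset, hyL _ h₂.subset]
    exact_mod_cast hlt₂

theorem IsFacetSet.card_inter_add_le (hM : IsSplit M) (h₁ : IsFacetSet M x L₁)
    (h₂ : IsFacetSet M x L₂) (hne : L₁ ≠ L₂) :
    #(L₁ ∩ L₂) + finsetRank M (component M x) ≤ finsetRank M L₁ + finsetRank M L₂ := by
  by_contra! hlt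
  have hlt' : finsetRank M L₂ + finsetRank M L₁ <
      #(L₂ ∩ L₁) + finsetRank M (component M x) := by
    rwa [Finset.inter_comm, add_comm (finsetRank M L₂)]
  obtain ⟨B₁, hB₁, hB₁₂⟩ := h₁.exists_mem_tightBases_notMem h₂ hne hlt
  obtain ⟨B₂, hB₂, hB₂₁⟩ := h₂.exists_mem_tightBases_notMem h₁ hne.symm hlt'
  obtain ⟨y₁, hy₁, hlt₁, hadd₁⟩ := h₁.exists_mem_ambientPolytope_lt h₂ hlt
  obtain ⟨y₂, hy₂, hlt₂, hadd₂⟩ := h₂.exists_mem_ambientPolytope_lt h₁ hlt'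
  obtain ⟨z, hz, hz₁, hz₂⟩ := exists_mem_lt_and_lt (f := (coordSum L₁).toLinearMap)
    (g := (coordSum L₂).toLinearMap) convex_ambientPolytope hy₁ hlt₁ hadd₁ hy₂ hlt₂
    (by simp only [ContinuousLinearMap.coe_coe]; linarith)
  obtain ⟨b, hb, hblt⟩ := exists_mem_openSlice_forall_lt M
  obtain ⟨y, hy, hy₁, hy₂⟩ := exists_apply_eq_and_apply_eq (f := (coordSum L₁).toLinearMap)
    (g := (coordSum L₂).toLinearMap) (fun _ h _ h' => openSegment_subset_openSlice h h')
    hb (hblt L₁ ⟨B₂, hB₂.1, hB₂₁⟩) hz hz₁ hz₂ (indVec_mem_ambientPolytope_of_mem_bases hB₁.1)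
    (coordSum_indVec_of_mem_tightBases hB₁) (coordSum_indVec_lt hB₁.1 hB₁₂)
    (indVec_mem_ambientPolytope_of_mem_bases hB₂.1) (coordSum_indVec_lt hB₂.1 hB₂₁)
    (coordSum_indVec_of_mem_tightBases hB₂)
  have hface : face M L₁ ≠ face M L₂ := fun h =>
    (coordSum_indVec_lt hB₁.1 hB₁₂).ne (h ▸ indVec_mem_face hB₁ : indVec B₁ ∈ face M L₂).2
  exact Set.disjoint_left.1 (hM _ _ (h₁.isFacet hB₂.1 hB₂₁) (h₂.isFacet hB₁.1 hB₁₂) hface)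
    ⟨h₁.mem_affineSpan_face hy.1 hy₁, h₂.mem_affineSpan_face hy.1 hy₂⟩
    (openSlice_subset_intrinsicInterior hy)

theorem splitSystem_of_isSplit (hM : IsSplit M) (x : α) :
    SplitSystem (bases M) (component M x) (finsetRank M (component M x))
      {L | IsFacetSet M x L} (finsetRank M) where
  card_inter _ hA := card_inter_component hA
  subset _ hL := hL.subset
  card_inter_le _ hA L _ := card_inter_le_finsetRank hA L
  exists_isTight _ hA _ _ he hf hex := by
    rw [Finset.mem_inter] at he
    rw [Finset.mem_sdiff] at hf
    obtain ⟨L, hL, hAL, hfL, heL⟩ := exists_isFacetSet hA he.1 he.2 hf.2 hf.1 hex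
    exact ⟨L, ⟨hL, hAL.2⟩, hfL, heL⟩
  card_inter_add_le _ h₁ _ h₂ hne := h₁.card_inter_add_le hM h₂ hne

theorem reflTransGen_pairExchange_bases (hM : IsSplit M) {p q : Finset α × Finset α}
    (hp : p.1 ∈ bases M ∧ p.2 ∈ bases M) (hq : q.1 ∈ bases M ∧ q.2 ∈ bases M)
    (hpq : PairCompatible p q) : Relation.ReflTransGen (PairExchange (bases M)) p q := by
  refine reflTransGen_pairExchange_of_canApproach (fun p q hp hq hpq hne => ?_) hp hq hpq
  obtain ⟨a, ha⟩ := Finset.sdiff_nonempty.2 fun h =>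
    hne (Finset.eq_of_subset_of_card_le h (card_eq_of_mem_bases hq.1 hp.1).le)
  exact (splitSystem_of_isSplit hM a).canApproach hp.1 hp.2 hq.1 hq.2 hpq ha
    (mem_component_self hp.1 (Finset.mem_sdiff.1 ha).1)

end SplitMatroids

section BasisSequences

variable {α : Type*} {M : Matroid α}

theorem ncard_setOf_mem_two (X : Fin 2 → Set α) (s : α) [Decidable (s ∈ X 0)]
    [Decidable (s ∈ X 1)] :
    {i | s ∈ X i}.ncard = (if s ∈ X 0 then 1 else 0) + (if s ∈ X 1 then 1 else 0) := by
  classical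
  rw [Set.ncard_eq_toFinset_card', Set.toFinset_ofPred, Finset.card_filter, Fin.sum_univ_two]
  congr

theorem SymmExchange.ncard_eq {X Y : Fin 2 → Set α} (h : SymmExchange M X Y) (s : α) :
    {i | s ∈ X i}.ncard = {i | s ∈ Y i}.ncard := by
  classical
  obtain ⟨i, j, hij, e, he, f, hf, -, -, rfl⟩ := h
  obtain ⟨rfl, rfl⟩ : i = 0 ∧ j = 1 := by omega
  rw [ncard_setOf_mem_two, ncard_setOf_mem_two]
  simp only [Function.update, Set.mem_sdiff] at *
  by_cases hse : s = e <;> by_cases hsf : s = f <;> simp_all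

theorem SeqEquivalent.seqCompatible {X Y : Fin 2 → Set α} (h : SeqEquivalent M X Y) :
    SeqCompatible M X Y := by
  intro s _
  induction h with
  | refl => rfl
  | tail _ hex ih => exact ih.trans (hex.ncard_eq s)

theorem exists_pair_bases_eq [M.Finite] {X : Fin 2 → Set α} (hX : ∀ i, M.IsBase (X i)) :
    ∃ p : Finset α × Finset α,
      (p.1 ∈ bases M ∧ p.2 ∈ bases M) ∧ ![(p.1 : Set α), p.2] = X := by
  obtain ⟨A, hA, hA₀⟩ := exists_mem_bases_coe_eq (hX 0)
  obtain ⟨A', hA', hA₁⟩ := exists_mem_bases_coe_eq (hX 1)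
  exact ⟨(A, A'), ⟨hA, hA'⟩, List.ofFn_inj.1 (by simp [hA₀, hA₁])⟩

variable [DecidableEq α] {p q : Finset α × Finset α}

theorem symmExchange_of_pairExchange (h : PairExchange (bases M) p q) :
    SymmExchange M ![(p.1 : Set α), p.2] ![(q.1 : Set α), q.2] := by
  obtain ⟨e, he, f, hf, h₁, h₂, rfl⟩ := h
  refine ⟨0, 1, by decide, e, by simpa using he, f, by simpa using hf,
    by simpa [bases] using h₁, by simpa [bases] using h₂, ?_⟩
  funext i
  fin_cases i <;> simp [Function.update]

theorem seqEquivalent_of_reflTransGen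
    (h : Relation.ReflTransGen (PairExchange (bases M)) p q) :
    SeqEquivalent M ![(p.1 : Set α), p.2] ![(q.1 : Set α), q.2] :=
  h.lift (fun p : Finset α × Finset α => ![(p.1 : Set α), p.2])
    fun _ _ => symmExchange_of_pairExchange

theorem pairCompatible_of_seqCompatible (hp : p.1 ∈ bases M ∧ p.2 ∈ bases M)
    (hq : q.1 ∈ bases M ∧ q.2 ∈ bases M)
    (h : SeqCompatible M ![(p.1 : Set α), p.2] ![(q.1 : Set α), q.2]) :
    PairCompatible p q := by
  classical
  have hmem (s : α) :
      (s ∈ p.1 ∧ s ∈ p.2 ↔ s ∈ q.1 ∧ s ∈ q.2) ∧ (s ∈ p.1 ∨ s ∈ p.2 ↔ s ∈ q.1 ∨ s ∈ q.2) := by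
    by_cases hs : s ∈ M.E
    · have hcount := h s hs
      rw [ncard_setOf_mem_two, ncard_setOf_mem_two] at hcount
      simp only [Matrix.cons_val_zero, Matrix.cons_val_one, Finset.mem_coe] at hcount
      split_ifs at hcount <;> first | omega | tauto
    · have hs' : ∀ {A : Finset α}, A ∈ bases M → s ∉ A :=
        fun hA h => hs (Matroid.IsBase.subset_ground hA h)
      simp only [hs' hp.1, hs' hp.2, hs' hq.1, hs' hq.2, or_self, and_self]
  constructor <;> ext s
  · simpa only [Finset.mem_inter] using (hmem s).1
  · simpa only [Finset.mem_union] using (hmem s).2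

end BasisSequences

/-- White's conjecture for basis sequences of length two in split matroids. -/
theorem corollary3p4 {α : Type*} (M : Matroid α) [M.Finite] (hM : IsSplit M)
    (X Y : Fin 2 → Set α) (hX : ∀ i, M.IsBase (X i)) (hY : ∀ i, M.IsBase (Y i)) :
    SeqEquivalent M X Y ↔ SeqCompatible M X Y := by
  classical
  refine ⟨SeqEquivalent.seqCompatible, fun h => ?_⟩
  obtain ⟨p, hp, rfl⟩ := exists_pair_bases_eq hX
  obtain ⟨q, hq, rfl⟩ := exists_pair_bases_eq hY
  have hpq : PairCompatible p q := pairCompatible_of_seqCompatible hp hq h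
  exact seqEquivalent_of_reflTransGen (reflTransGen_pairExchange_bases hM hp hq hpq)
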